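/- **Conventions.** Let $p>2$ be a prime and let $H$ be the quaternion algebra over $\mathbb{Q}$ ramified exactly at $p$ and $\infty$, with reduced norm $N$, reduced trace $\mathrm{Tr}$, and $\Delta(x)=\mathrm{Tr}(x)^2-4N(x)$. For a lattice $\mathfrak a\subset H$ (always of full rank) put $N(\mathfrak a)=\gcd\{N(x):x\in\mathfrak a\}$, and let $\mathfrak a_q=\mathfrak a\otimes\mathbb{Z}_q\subset H_q=H\otimes\mathbb{Q}_q$ for a prime $q$. A left ideal of an order $R$ is a lattice $\mathfrak a$ such that for every prime $q$ there is $x_q\in H_q^\times$ with $\mathfrak a_q=R_qx_q$. Two left $R$-ideals $\mathfrak a,\mathfrak b$ are equivalent if $\mathfrak a=\mathfrak b x$ with $x\in H^\times$; $[\mathfrak a]$ is the class of $\mathfrak a$, $\mathcal I(R)$ is the set of classes, and $\mathrm{Cls}(A)=\{[\mathfrak a]:\mathfrak a\in A\}$ for a set $A$ of left $R$-ideals. The right order of $\mathfrak a$ is $\{x\in H:\mathfrak a x\subseteq\mathfrak a\}$. If $R,R'$ are orders and $\mathfrak a$ is a left $R$-ideal, put $$\Psi^{R}_{R'}(\mathfrak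 a)=\{\mathfrak b\ \text{a left } R'\text{-ideal}:\ \mathfrak b\subseteq\mathfrak a,\ N(\mathfrak b)=N(\mathfrak a)\}.$$ Let $\mathcal O$ be a maximal order of $H$, let $\tilde{\mathcal O}=\{x\in\mathcal O: p\mid\Delta(x)\}$ (the unique order of index $p$ in $\mathcal O$), and let $\mathcal O'$ be an order of level $p^2$, i.e. an order of index $p$ in $\tilde{\mathcal O}$. Let $$\mathcal H=\mathbb{Z}_p^\times(1+p\mathcal O_p)\backslash\mathcal O_p^\times,\quad \mathcal G=\mathbb{Z}_p^\times(1+p\mathcal O_p)\backslash\tilde{\mathcal O}_p^\times,\quad \mathcal S=\mathbb{Z}_p^\times(1+p\mathcal O_p)\backslash(\mathcal O'_p)^\times .$$ **Theorem.** $\mathcal G$ is normal in $\mathcal H$, $\mathcal S$ is normal in $\mathcal G$, and: 1. $\mathcal I(\tilde{\mathcal O})=\bigsqcup_{[\mathfrak a]\in\mathcal I(\mathcal O)}\mathrm{Cls}\bigl(\Psi^{\mathcal O}_{\tilde{\mathcal O}}(\mathfrak a)\bigr)$, a disjoint union in which each term depends only on the class $[\mathfrak a]$. 2. The group $\mathcal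 G\backslash\mathcal H$ is cyclic, and for every left $\mathcal O$-ideal $\mathfrak a$ the set $\Psi^{\mathcal O}_{\tilde{\mathcal O}}(\mathfrak a)$ is a principal homogeneous space for it. Here the class of $g\in\mathcal O_p^\times$ sends $\mathfrak b$ to the lattice $\mathfrak c$ with $\mathfrak c_p=\mathfrak b_p g$ and $\mathfrak c_q=\mathfrak b_q$ for all primes $q\ne p$. 3. $\mathcal I(\mathcal O')=\bigsqcup_{[\mathfrak b]\in\mathcal I(\tilde{\mathcal O})}\mathrm{Cls}\bigl(\Psi^{\tilde{\mathcal O}}_{\mathcal O'}(\mathfrak b)\bigr)$, a disjoint union in which each term depends only on the class $[\mathfrak b]$. For every left $\tilde{\mathcal O}$-ideal $\mathfrak b$ we have $\#\Psi^{\tilde{\mathcal O}}_{\mathcal O'}(\mathfrak b)=p$; if moreover $p>3$, then also $\#\mathrm{Cls}\bigl(\Psi^{\tilde{\mathcal O}}_{\mathcal O'}(\mathfrak b)\bigr)=p$, i.e. the $p$ elements are pairwise inequivalent. 4. For every left $\tilde{\mathcal O}$-ideal $\mathfrak b$, all elements of $\Psi^{\tilde{\mathcal O}}_{\mathcal O'}(\mathfrak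 b)$ have the same right order. 5. For every left $\tilde{\mathcal O}$-ideal $\mathfrak b$, the set $\Psi^{\tilde{\mathcal O}}_{\mathcal O'}(\mathfrak b)$ is a principal homogeneous space for $\mathcal S\backslash\mathcal G$. Here the class of $g\in\tilde{\mathcal O}_p^\times$ sends $\mathfrak c$, with $\mathfrak c_p=\mathcal O'_p x_p$, to the lattice $\mathfrak d$ with $\mathfrak d_p=\mathcal O'_p\,g\,x_p$ and $\mathfrak d_q=\mathfrak c_q$ for all primes $q\ne p$. -/

import Mathlib

open scoped Quaternion Pointwise

noncomputable section

namespace QuatIdeals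

/-- The quaternion algebra `(α, β)` over `ℚ`, with `i² = α`, `j² = β`, `k = ij = -ji`. -/
abbrev Quat (α β : ℚ) : Type := ℍ[ℚ, α, β]

/-- Its completion at the prime `q`, the same quaternion algebra over `ℚ_q`. -/
abbrev LQuat (α β : ℚ) (q : ℕ) [Fact q.Prime] : Type := ℍ[ℚ_[q], (α : ℚ_[q]), (β : ℚ_[q])]

/-- The quaternion algebra `(α, β)` is ramified over the field `K` when it is a
division ring over `K`. -/
def IsRamifiedOver (K : Type*) [Field K] (α β : K) : Prop :=
  ∀ x : ℍ[K, α, β], x ≠ 0 → IsUnit x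

/-- `(α, β)` is ramified exactly at the prime `p` and at infinity. -/
def IsRamifiedExactlyAt (α β : ℚ) (p : ℕ) : Prop :=
  IsRamifiedOver ℝ (α : ℝ) (β : ℝ) ∧
    ∀ (q : ℕ) [Fact q.Prime], IsRamifiedOver ℚ_[q] (α : ℚ_[q]) (β : ℚ_[q]) ↔ q = p

variable {α β : ℚ}

/-- Reduced norm. -/
def nrd (x : Quat α β) : ℚ := (x * star x).re

/-- Reduced trace. -/
def trd (x : Quat α β) : ℚ := (x + star x).re

/-- The discriminant of the (reduced) characteristic polynomial of `x`. -/
def discr (x : Quat α β) : ℚ := trd x ^ 2 - 4 * nrd x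

/-! ### Lattices and orders -/

/-- A full `ℤ`-lattice in the quaternion algebra. -/
abbrev IsLat (L : Submodule ℤ (Quat α β)) : Prop := Submodule.IsLattice ℚ L

/-- A subring regarded as a `ℤ`-submodule. -/
abbrev asLat (O : Subring (Quat α β)) : Submodule ℤ (Quat α β) :=
  AddSubgroup.toIntSubmodule O.toAddSubgroup

/-- An order: a subring (with `1`) which is a lattice. -/
def IsOrder (O : Subring (Quat α β)) : Prop := IsLat (asLat O)

/-- A maximal order. -/
def IsMaximalOrder (O : Subring (Quat α β)) : Prop := Maximal IsOrder O

/-- `n` is the greatest common divisor of the set `S` of rational numbers: the nonnegative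
generator of the subgroup of `ℚ` generated by `S`. -/
def IsRatGcd (S : Set ℚ) (n : ℚ) : Prop :=
  0 ≤ n ∧ Submodule.span ℤ S = Submodule.span ℤ {n}

open Classical in
/-- The norm of a lattice: the gcd of the reduced norms of its elements (the value `0` is a
default used only when there is no gcd, which does not happen for lattices). -/
def latNorm (L : Submodule ℤ (Quat α β)) : ℚ :=
  if h : ∃ n, IsRatGcd (nrd '' (L : Set (Quat α β))) n then h.choose else 0

/-- The right order of a lattice `L`: all `x` with `L x ⊆ L`. -/
def rightOrder (L : Submodule ℤ (Quat α β)) : Subring (Quat α β) where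
  carrier := {x | ∀ y ∈ L, y * x ∈ L}
  mul_mem' := fun {x z} hx hz y hy => by
    rw [← mul_assoc]; exact hz _ (hx y hy)
  one_mem' := fun y hy => by simpa using hy
  add_mem' := fun {x z} hx hz y hy => by
    rw [mul_add]; exact L.add_mem (hx y hy) (hz y hy)
  zero_mem' := fun y _ => by simp
  neg_mem' := fun {x} hx y hy => by
    rw [mul_neg]; exact L.neg_mem (hx y hy)

/-- The lattice `L x`. -/
def rmul (L : Submodule ℤ (Quat α β)) (x : Quat α β) : Submodule ℤ (Quat α β) :=
  L.map (LinearMap.mulRight ℤ x)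

/-! ### Localization -/

/-- The inclusion of the rational quaternion algebra in its completion at `q`. -/
def toLocal (q : ℕ) [Fact q.Prime] : Quat α β →+* LQuat α β q where
  toFun x := ⟨(x.re : ℚ_[q]), (x.imI : ℚ_[q]), (x.imJ : ℚ_[q]), (x.imK : ℚ_[q])⟩
  map_one' := by ext <;> simp
  map_mul' x y := by ext <;> simp
  map_zero' := by ext <;> simp
  map_add' x y := by ext <;> simp

/-- The localization `L_q = L ⊗ ℤ_q`, as the `ℤ_q`-span of `L` in the completion at `q`. -/
def loc (q : ℕ) [Fact q.Prime] (L : Submodule ℤ (Quat α β)) :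
    Submodule ℤ_[q] (LQuat α β q) :=
  Submodule.span ℤ_[q] (toLocal q '' (L : Set (Quat α β)))

/-- The local lattice `M x`. -/
def locRmul {q : ℕ} [Fact q.Prime] (M : Submodule ℤ_[q] (LQuat α β q)) (x : LQuat α β q) :
    Submodule ℤ_[q] (LQuat α β q) :=
  M.map (LinearMap.mulRight ℤ_[q] x)

/-- The localization `O_q` of the order `O`. -/
abbrev locOrd (q : ℕ) [Fact q.Prime] (O : Subring (Quat α β)) :
    Submodule ℤ_[q] (LQuat α β q) := loc q (asLat O)

lemma one_mem_locOrd (q : ℕ) [Fact q.Prime] (O : Subring (Quat α β)) :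
    (1 : LQuat α β q) ∈ locOrd q O :=
  Submodule.subset_span ⟨1, O.one_mem, map_one _⟩

lemma mul_mem_locOrd {q : ℕ} [Fact q.Prime] {O : Subring (Quat α β)} {x y : LQuat α β q}
    (hx : x ∈ locOrd q O) (hy : y ∈ locOrd q O) : x * y ∈ locOrd q O := by
  have h := Submodule.mul_mem_mul hx hy
  rw [locOrd, loc, Submodule.span_mul_span] at h
  refine Submodule.span_mono ?_ h
  rintro _ ⟨_, ⟨u, hu, rfl⟩, _, ⟨v, hv, rfl⟩, rfl⟩
  exact ⟨u * v, O.mul_mem hu hv, map_mul _ _ _⟩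

lemma scalar_mul_mem_locOrd {q : ℕ} [Fact q.Prime] {O : Subring (Quat α β)} (r : ℤ_[q])
    {x : LQuat α β q} (hx : x ∈ locOrd q O) : algebraMap ℤ_[q] _ r * x ∈ locOrd q O := by
  rw [← Algebra.smul_def]; exact Submodule.smul_mem _ _ hx

/-- The unit group `O_q^×` of the local order, inside the unit group of the completion. -/
def locUnits (q : ℕ) [Fact q.Prime] (O : Subring (Quat α β)) : Subgroup (LQuat α β q)ˣ where
  carrier := {x | (x : LQuat α β q) ∈ locOrd q O ∧ ((x⁻¹ : (LQuat α β q)ˣ) : LQuat α β q) ∈ locOrd q O}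
  mul_mem' := fun {x y} hx hy =>
    ⟨by simpa using mul_mem_locOrd hx.1 hy.1, by simpa using mul_mem_locOrd hy.2 hx.2⟩
  one_mem' := ⟨by simpa using one_mem_locOrd q O, by simpa using one_mem_locOrd q O⟩
  inv_mem' := fun {x} hx => ⟨hx.2, by simpa using hx.1⟩

/-! ### Left ideals, classes, subideals -/

/-- `I(O)`, the set of left `O`-ideals: lattices that are locally principal,
`a_q = O_q x_q` with `x_q` invertible, for every prime `q`. -/
def leftIdeals (O : Subring (Quat α β)) : Set (Submodule ℤ (Quat α β)) :=
  {a | IsLat a ∧ ∀ (q : ℕ) [Fact q.Prime],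
    ∃ x : (LQuat α β q)ˣ, loc q a = locRmul (locOrd q O) x}

/-- Two left ideals are in the same class if `a = b x` with `x` invertible. -/
def classSetoid (O : Subring (Quat α β)) : Setoid (leftIdeals O) where
  r a b := ∃ x : (Quat α β)ˣ, (a : Submodule ℤ (Quat α β)) = rmul b x
  iseqv := by
    refine ⟨fun a => ⟨1, ?_⟩, ?_, ?_⟩
    · ext y; simp [rmul]
    · rintro a b ⟨x, hx⟩
      refine ⟨x⁻¹, ?_⟩
      rw [hx, rmul, rmul, ← Submodule.map_comp]
      ext y; simp
    · rintro a b c ⟨x, hx⟩ ⟨y, hy⟩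
      refine ⟨y * x, ?_⟩
      rw [hx, hy, rmul, rmul, rmul, ← Submodule.map_comp]
      ext z; simp [mul_assoc]

/-- The set of left `O`-ideal classes. -/
abbrev IdealClasses (O : Subring (Quat α β)) : Type := Quotient (classSetoid O)

/-- The class `[a]`. -/
abbrev cls {O : Subring (Quat α β)} (a : leftIdeals O) : IdealClasses O :=
  Quotient.mk (classSetoid O) a

/-- The set of classes of the ideals in a set `A` of left `O`-ideals. -/
def Cls (O : Subring (Quat α β)) (A : Set (Submodule ℤ (Quat α β))) : Set (IdealClasses O) :=
  {c | ∃ b : leftIdeals O, (b : Submodule ℤ (Quat α β)) ∈ A ∧ cls b = c}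

/-- The subideal set `Ψ_{O'}(a)`: left `O'`-ideals contained in `a` and of the same norm. -/
def Psi (O' : Subring (Quat α β)) (a : Submodule ℤ (Quat α β)) :
    Set (Submodule ℤ (Quat α β)) :=
  {b | b ∈ leftIdeals O' ∧ b ≤ a ∧ latNorm b = latNorm a}

/-- The classes of left `O'`-ideals are the disjoint union, over the classes `[a]` of left
`O`-ideals, of the sets `Cls (Ψ_{O'}(a))`; these sets depend only on the class of `a`. -/
def ClassesDecompose (O O' : Subring (Quat α β)) : Prop :=
  ∃ Φ : IdealClasses O → Set (IdealClasses O'),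
    (∀ a : leftIdeals O, Φ (cls a) = Cls O' (Psi O' (a : Submodule ℤ (Quat α β)))) ∧
    (Pairwise fun u v => Disjoint (Φ u) (Φ v)) ∧ (⋃ u, Φ u) = Set.univ

/-! ### Orders of level `p²` and the groups `ℋ`, `𝒢`, `𝒮` -/

/-- `O'` is an order of index `p` in `Ot`. -/
def IsOrderOfIndex (p : ℕ) (Ot O' : Subring (Quat α β)) : Prop :=
  IsOrder O' ∧ O' ≤ Ot ∧ O'.toAddSubgroup.relIndex Ot.toAddSubgroup = p

lemma congr_mul_aux {R A : Type*} [CommRing R] [Ring A] [Algebra R A] (p : ℕ) (r s : R)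
    (y z : A) : algebraMap R A r * (1 + (p : A) * y) * (algebraMap R A s * (1 + (p : A) * z)) =
      algebraMap R A (r * s) * (1 + (p : A) * (y + z + algebraMap R A (p : R) * (y * z))) := by
  have c1 : (1 + (p : A) * y) * algebraMap R A s = algebraMap R A s * (1 + (p : A) * y) :=
    (Algebra.commutes s _).symm
  have c2 : y * (p : A) = (p : A) * y := (Nat.cast_commute p y).eq.symm
  have e : (1 + (p : A) * y) * (1 + (p : A) * z) =
      1 + (p : A) * (y + z + (p : A) * (y * z)) := by
    have c3 : (p : A) * y * ((p : A) * z) = (p : A) * ((p : A) * (y * z)) := by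
      rw [mul_assoc, ← mul_assoc y, c2, mul_assoc]
    rw [add_mul, mul_add, mul_add, c3, mul_add, mul_add]
    simp only [one_mul, mul_one]
    abel
  rw [map_mul, map_natCast, ← e]
  simp only [mul_assoc]
  rw [← mul_assoc (1 + (p : A) * y), c1]
  simp only [mul_assoc]

lemma congr_inv_aux {R A : Type*} [CommRing R] [Ring A] [Algebra R A] (p : ℕ) (u : Rˣ)
    (y : A) (x : Aˣ) (h : (x : A) = algebraMap R A u * (1 + (p : A) * y)) :
    ((x⁻¹ : Aˣ) : A) = algebraMap R A ((u⁻¹ : Rˣ) : R) *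
      (1 + (p : A) * -(algebraMap R A u * (y * ((x⁻¹ : Aˣ) : A)))) := by
  set U : A := algebraMap R A u with hU
  set V : A := algebraMap R A ((u⁻¹ : Rˣ) : R) with hV
  have hVU : V * U = 1 := by rw [hU, hV, ← map_mul]; simp
  have c2 : (p : A) * U = U * p := (Nat.cast_commute p U).eq
  have key : (1 + (p : A) * -(U * (y * ((x⁻¹ : Aˣ) : A)))) * x = U := by
    simp only [add_mul, one_mul, mul_neg, neg_mul, mul_assoc, Units.inv_mul, mul_one]
    rw [h, mul_add, mul_one, ← mul_assoc, ← mul_assoc, c2]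
    abel
  rw [← Units.mul_left_inj x, Units.inv_mul, mul_assoc, key, hVU]

lemma congr_conj_aux {R A : Type*} [CommRing R] [Ring A] [Algebra R A] (p : ℕ) (r : R)
    (y : A) (g : Aˣ) :
    (g : A) * (algebraMap R A r * (1 + (p : A) * y)) * ((g⁻¹ : Aˣ) : A) =
      algebraMap R A r * (1 + (p : A) * ((g : A) * y * ((g⁻¹ : Aˣ) : A))) := by
  have c1 := Algebra.commutes r (g : A)
  have c2 := (Nat.cast_commute p (g : A)).eq
  rw [← mul_assoc, ← c1, mul_assoc, mul_assoc]
  congr 1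
  rw [← mul_assoc, mul_add, mul_one, add_mul, Units.mul_inv]
  simp only [← mul_assoc, c2]

/-- The subgroup `ℤ_p^× (1 + p O_p)` of `O_p^×`. -/
def congrUnits (p : ℕ) [Fact p.Prime] (O : Subring (Quat α β)) : Subgroup (locUnits p O) where
  carrier := {x | ∃ u : ℤ_[p]ˣ, ∃ y ∈ locOrd p O,
    ((x : (LQuat α β p)ˣ) : LQuat α β p) =
      algebraMap ℤ_[p] _ (u : ℤ_[p]) * (1 + (p : LQuat α β p) * y)}
  mul_mem' := by
    rintro x x' ⟨u, y, hy, h⟩ ⟨u', y', hy', h'⟩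
    refine ⟨u * u', y + y' + algebraMap ℤ_[p] _ (p : ℤ_[p]) * (y * y'),
      Submodule.add_mem _ (Submodule.add_mem _ hy hy')
        (scalar_mul_mem_locOrd _ (mul_mem_locOrd hy hy')), ?_⟩
    rw [Subgroup.coe_mul, Units.val_mul, h, h', Units.val_mul]
    exact congr_mul_aux p _ _ y y'
  one_mem' := ⟨1, 0, Submodule.zero_mem _, by simp⟩
  inv_mem' := by
    rintro x ⟨u, y, hy, h⟩
    exact ⟨u⁻¹, _, Submodule.neg_mem _ (scalar_mul_mem_locOrd _ (mul_mem_locOrd hy x.2.2)),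
      congr_inv_aux p u y x.1 h⟩

instance congrUnits_normal (p : ℕ) [Fact p.Prime] (O : Subring (Quat α β)) :
    (congrUnits p O).Normal where
  conj_mem := by
    rintro x ⟨u, y, hy, h⟩ g
    refine ⟨u, _, mul_mem_locOrd (mul_mem_locOrd g.2.1 hy) g.2.2, ?_⟩
    have e := congr_conj_aux p (u : ℤ_[p]) y g.1
    rw [← h] at e
    exact e

/-- The group `ℋ = ℤ_p^× (1 + p O_p) \ O_p^×`. -/
abbrev GroupH (p : ℕ) [Fact p.Prime] (O : Subring (Quat α β)) : Type :=
  locUnits p O ⧸ congrUnits p O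

/-- The class in `ℋ` of an element of `O_p^×`. -/
abbrev toH {p : ℕ} [Fact p.Prime] {O : Subring (Quat α β)} (g : locUnits p O) : GroupH p O :=
  QuotientGroup.mk g

/-- For an order `ℤ + pO ⊆ R ⊆ O`, the group `ℤ_p^× (1 + p O_p) \ R_p^×`, as a subgroup of `ℋ`.
It is `𝒢` for `R` the order of index `p` in `O`, and `𝒮` for `R` an order of level `p²`. -/
def subH (p : ℕ) [Fact p.Prime] (O R : Subring (Quat α β)) : Subgroup (GroupH p O) :=
  ((locUnits p R).subgroupOf (locUnits p O)).map (QuotientGroup.mk' (congrUnits p O))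

/-- The group `𝒮` inside the group `𝒢`, for `Ot` of index `p` in `O` and `O'` of level `p²`. -/
abbrev subG (p : ℕ) [Fact p.Prime] (O Ot O' : Subring (Quat α β)) : Subgroup (subH p O Ot) :=
  (subH p O O').subgroupOf (subH p O Ot)

/-- `c` is the lattice obtained from `b` by right multiplication by the adele which is `g` at `p`
and `1` at all other primes. -/
def IsRightTranslate (p : ℕ) [Fact p.Prime] (g : (LQuat α β p)ˣ)
    (b c : Submodule ℤ (Quat α β)) : Prop :=
  loc p c = locRmul (loc p b) g ∧ ∀ (q : ℕ) [Fact q.Prime], q ≠ p → loc q c = loc q b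

/-- For a left `R`-ideal `b`, the lattice `c` is `g · b`: it satisfies `c_p = R_p g x_p` whenever
`b_p = R_p x_p`, and `c_q = b_q` at all other primes. -/
def IsLeftTranslate (p : ℕ) [Fact p.Prime] (R : Subring (Quat α β)) (g : (LQuat α β p)ˣ)
    (b c : Submodule ℤ (Quat α β)) : Prop :=
  (∀ x : (LQuat α β p)ˣ, loc p b = locRmul (locOrd p R) x →
    loc p c = locRmul (locOrd p R) ((g * x : (LQuat α β p)ˣ) : LQuat α β p)) ∧
  ∀ (q : ℕ) [Fact q.Prime], q ≠ p → loc q c = loc q b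

end QuatIdeals

end

open QuatIdeals

/-!
The proof is local at `p`. There `H_p` is a division algebra, and its reduced norm gives an
ultrametric absolute value: integrality of the trace follows from integrality of the norm by
Hensel's lemma (`IsRamifiedOver.norm_tr_le`). Hence `{|N| ≤ 1}` is a ring with a prime ideal
`P = {|N| < 1}`. It is the completion of the maximal order `O`
(`IsMaximalOrder.mem_locOrd`), because the trace form bounds it and so its intersection with
`O[1/p]` is a global order containing `O`. The residue ring `O_p / P` is finite, so by Wedderburn's
little theorem it is a field with cyclic unit group; as `i` and `j` anticommute, they cannot both
be scaled to units, so some norm has odd valuation (`IsRamifiedOver.exists_uniformizer`) and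
`P² = pO_p`.

Completing the square in the characteristic polynomial gives `Ot_p = ℤ_p + P`
(`IsLevelTower.mem_locOrd_Ot`), which is stable under conjugation by all of `H_p^×`; thus
`𝒢 \ ℋ` is a quotient of the cyclic group `(O_p / P)^×`. An order `O'` of index `p` in `Ot`
contains `pO_p = P²` locally (`IsLevelTower.smul_mem_locOrd_O'`). Since commutators in `ℤ_p + P` lie
in `P²`, the group `Ot_p^×` normalizes `O'_p`, which gives the normality of `𝒮` in `𝒢` and the
equality of right orders.

A lattice is determined by its completions, and the completion at `p` may be changed at will
(`exists_lat_of_loc`). The norm of a locally principal lattice is read off from its local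
generators (`norm_latNorm`), so if `R' ⊆ R` agree away from `p` and `a_p = R_p y`, the left
`R'`-ideals in `a` of the same norm are exactly the lattices with completion `R'_p u y`,
`u ∈ R_p^×`, at `p` and that of `a` elsewhere (`AgreeAwayFrom.mem_Psi_iff`). They are
parametrized by `R'_p^× \ R_p^×`, and `a = R b` is determined by any such `b`, which gives the
decompositions of the class sets and the torsor structures. The cardinality `p` comes from
the bijection `x ↦ 1 + (x - tr(x)/2)` of `Ot / O'` with `O'_p^× \ Ot_p^×`.

Finally, if `c = d x` with `c, d` in the same set over `b`, then `b = b x`, so `x` has norm `1`,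
integral trace, and discriminant `tr(x)² - 4 ∈ {0, -3, -4}` by definiteness; it is divisible by
`p`, so `x = ±1` when `p > 3`.
-/

noncomputable section

namespace QuatIdeals

/-! ### Reduced norm and trace over a field -/

section Algebra

variable {K : Type*} [Field K] {a b : K}

/-- The reduced norm of `(a, b)` over an arbitrary field. -/
def nm (x : ℍ[K, a, b]) : K := (x * star x).re

/-- The reduced trace of `(a, b)` over an arbitrary field. -/
def tr (x : ℍ[K, a, b]) : K := (x + star x).re

lemma nm_eq (x : ℍ[K, a, b]) :
    nm x = x.re ^ 2 - a * x.imI ^ 2 - b * x.imJ ^ 2 + a * b * x.imK ^ 2 := by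
  simp [nm]; ring

lemma tr_eq (x : ℍ[K, a, b]) : tr x = 2 * x.re := by
  simp [tr]; ring

lemma mul_star_eq (x : ℍ[K, a, b]) : x * star x = algebraMap K _ (nm x) :=
  QuaternionAlgebra.mul_star_eq_coe x

lemma nm_star (x : ℍ[K, a, b]) : nm (star x) = nm x := by
  simp [nm_eq]

lemma star_mul_eq (x : ℍ[K, a, b]) : star x * x = algebraMap K _ (nm x) := by
  simpa [nm_star] using mul_star_eq (star x)

lemma nm_mul (x y : ℍ[K, a, b]) : nm (x * y) = nm x * nm y := by
  simp only [nm_eq, QuaternionAlgebra.re_mul, QuaternionAlgebra.imI_mul,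
    QuaternionAlgebra.imJ_mul, QuaternionAlgebra.imK_mul]
  ring

@[simp] lemma nm_one : nm (1 : ℍ[K, a, b]) = 1 := by simp [nm_eq]

@[simp] lemma nm_zero : nm (0 : ℍ[K, a, b]) = 0 := by simp [nm_eq]

lemma nm_pow (x : ℍ[K, a, b]) (n : ℕ) : nm (x ^ n) = nm x ^ n := by
  induction n with
  | zero => simp
  | succ n ih => rw [pow_succ, nm_mul, ih, pow_succ]

lemma nm_algebraMap (r : K) : nm (algebraMap K ℍ[K, a, b] r) = r ^ 2 := by
  simp [nm_eq, QuaternionAlgebra.algebraMap_eq]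

lemma tr_algebraMap (r : K) : tr (algebraMap K ℍ[K, a, b] r) = 2 * r := by
  simp [tr_eq, QuaternionAlgebra.algebraMap_eq]

lemma nm_natCast (n : ℕ) : nm (n : ℍ[K, a, b]) = (n : K) ^ 2 := by
  rw [← map_natCast (algebraMap K ℍ[K, a, b]), nm_algebraMap]

lemma nm_neg (x : ℍ[K, a, b]) : nm (-x) = nm x := by simp [nm_eq]

lemma tr_add (x y : ℍ[K, a, b]) : tr (x + y) = tr x + tr y := by simp [tr_eq]; ring

lemma nm_add (x y : ℍ[K, a, b]) : nm (x + y) = nm x + nm y + tr (x * star y) := by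
  simp [nm_eq, tr_eq]; ring

lemma nm_one_add (x : ℍ[K, a, b]) : nm (1 + x) = 1 + tr x + nm x := by
  simp [nm_eq, tr_eq]; ring

lemma tr_mul_comm (x y : ℍ[K, a, b]) : tr (x * y) = tr (y * x) := by
  simp only [tr_eq, QuaternionAlgebra.re_mul]; ring

lemma star_eq (x : ℍ[K, a, b]) : star x = algebraMap K _ (tr x) - x := by
  ext <;> simp [tr_eq, QuaternionAlgebra.algebraMap_eq]; ring

lemma nm_two_mul_sub (x : ℍ[K, a, b]) :
    nm (2 * x - algebraMap K _ (tr x)) = -(tr x ^ 2 - 4 * nm x) := by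
  rw [two_mul]
  simp [nm_eq, tr_eq, QuaternionAlgebra.algebraMap_eq]; ring

/-- The characteristic equation in factored form. -/
lemma sub_mul_sub (x : ℍ[K, a, b]) (r s : K) (h₁ : r + s = tr x) (h₂ : r * s = nm x) :
    (x - algebraMap K _ r) * (x - algebraMap K _ s) = 0 := by
  have h : x * x = algebraMap K _ (tr x) * x - algebraMap K _ (nm x) := by
    rw [← star_mul_eq, star_eq]; noncomm_ring
  rw [sub_mul, mul_sub, mul_sub, h, ← h₁, ← h₂, ← Algebra.commutes s x, map_add, map_mul]
  noncomm_ring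

lemma tr_conj (x : ℍ[K, a, b]) (u : (ℍ[K, a, b])ˣ) :
    tr ((u : ℍ[K, a, b]) * x * ((u⁻¹ : (ℍ[K, a, b])ˣ) : ℍ[K, a, b])) = tr x := by
  rw [tr_mul_comm, ← mul_assoc, Units.inv_mul, one_mul]

lemma nm_unit_mul_inv (u : (ℍ[K, a, b])ˣ) :
    nm (u : ℍ[K, a, b]) * nm ((u⁻¹ : (ℍ[K, a, b])ˣ) : ℍ[K, a, b]) = 1 := by
  rw [← nm_mul, Units.mul_inv, nm_one]

lemma nm_unit_ne_zero (u : (ℍ[K, a, b])ˣ) : nm (u : ℍ[K, a, b]) ≠ 0 :=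
  left_ne_zero_of_mul_eq_one (nm_unit_mul_inv u)

lemma nm_unit_inv (u : (ℍ[K, a, b])ˣ) :
    nm ((u⁻¹ : (ℍ[K, a, b])ˣ) : ℍ[K, a, b]) = (nm (u : ℍ[K, a, b]))⁻¹ :=
  eq_inv_of_mul_eq_one_right (nm_unit_mul_inv u)

lemma nm_conj (x : ℍ[K, a, b]) (u : (ℍ[K, a, b])ˣ) :
    nm ((u : ℍ[K, a, b]) * x * ((u⁻¹ : (ℍ[K, a, b])ˣ) : ℍ[K, a, b])) = nm x := by
  rw [nm_mul, nm_mul, mul_right_comm, nm_unit_mul_inv, one_mul]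

lemma unit_inv_eq (u : (ℍ[K, a, b])ˣ) : ((u⁻¹ : (ℍ[K, a, b])ˣ) : ℍ[K, a, b]) =
    algebraMap K _ (nm (u : ℍ[K, a, b]))⁻¹ * star (u : ℍ[K, a, b]) := by
  rw [← Units.mul_left_inj u, Units.inv_mul, mul_assoc, star_mul_eq, ← map_mul,
    inv_mul_cancel₀ (nm_unit_ne_zero u), map_one]

/-- An element of nonzero reduced norm is a unit. -/
lemma exists_unit_of_nm_ne_zero {x : ℍ[K, a, b]} (h : nm x ≠ 0) :
    ∃ u : (ℍ[K, a, b])ˣ, (u : ℍ[K, a, b]) = x := by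
  refine ⟨⟨x, algebraMap K _ (nm x)⁻¹ * star x, ?_, ?_⟩, rfl⟩
  · rw [← mul_assoc, ← Algebra.commutes, mul_assoc, mul_star_eq, ← map_mul, inv_mul_cancel₀ h,
      map_one]
  · rw [mul_assoc, star_mul_eq, ← map_mul, inv_mul_cancel₀ h, map_one]

lemma IsRamifiedOver.nm_ne_zero (h : IsRamifiedOver K a b) {x : ℍ[K, a, b]} (hx : x ≠ 0) :
    nm x ≠ 0 := by
  obtain ⟨u, rfl⟩ := h x hx
  exact nm_unit_ne_zero u

lemma IsRamifiedOver.nm_eq_zero (h : IsRamifiedOver K a b) {x : ℍ[K, a, b]} :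
    nm x = 0 ↔ x = 0 :=
  ⟨fun h0 => by_contra fun hx => h.nm_ne_zero hx h0, fun h0 => by simp [h0]⟩

lemma IsRamifiedOver.mul_eq_zero (h : IsRamifiedOver K a b) {x y : ℍ[K, a, b]}
    (hxy : x * y = 0) : x = 0 ∨ y = 0 := by
  simpa [nm_mul, h.nm_eq_zero] using congrArg nm hxy

lemma IsRamifiedOver.ne_zero (h : IsRamifiedOver K a b) : a ≠ 0 ∧ b ≠ 0 := by
  constructor <;> rintro rfl
  · refine h.nm_ne_zero (x := ⟨0, 1, 0, 0⟩) (fun h => ?_) (by simp [nm_eq])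
    simpa using congrArg QuaternionAlgebra.imI h
  · refine h.nm_ne_zero (x := ⟨0, 0, 1, 0⟩) (fun h => ?_) (by simp [nm_eq])
    simpa using congrArg QuaternionAlgebra.imJ h

end Algebra

/-! ### The division algebra over `ℚ_p` and its valuation ring -/

section Division

variable {p : ℕ} [Fact p.Prime] {a b : ℚ_[p]}

/-- Hensel's lemma splits a polynomial `X² - tX + n` with `|t| > 1 ≥ |n|`; hence in a division
algebra an integral norm forces an integral trace. -/
lemma IsRamifiedOver.norm_tr_le (h : IsRamifiedOver ℚ_[p] a b) {x : ℍ[ℚ_[p], a, b]}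
    (hx : ‖nm x‖ ≤ 1) : ‖tr x‖ ≤ 1 := by
  by_contra! ht
  have ht0 : tr x ≠ 0 := by rintro h0; simp [h0] at ht; linarith
  have hm : ‖nm x / tr x ^ 2‖ < 1 := by
    rw [norm_div, norm_pow, div_lt_one (by positivity)]
    exact hx.trans_lt (one_lt_pow₀ ht two_ne_zero)
  set m : ℤ_[p] := ⟨nm x / tr x ^ 2, hm.le⟩ with hmdef
  let F : Polynomial ℤ_[p] := Polynomial.X ^ 2 - Polynomial.X + Polynomial.C m
  have hm' : ‖m‖ < 1 := hm
  obtain ⟨z, hz, -⟩ := hensels_lemma (p := p) (R := ℤ_[p]) (F := F) (a := 0)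
    (by simpa [F] using hm')
  have hz' : (z : ℚ_[p]) ^ 2 - z + nm x / tr x ^ 2 = 0 := by
    have : z ^ 2 - z + m = 0 := by simpa [F] using hz
    have h1 := congrArg (fun w : ℤ_[p] => (w : ℚ_[p])) this
    push_cast at h1
    exact h1
  have scalar : ∀ s : ℚ_[p], x ≠ algebraMap ℚ_[p] _ s := by
    rintro s rfl
    rw [nm_algebraMap, norm_pow, sq_le_one_iff₀ (norm_nonneg _)] at hx
    rw [tr_algebraMap, norm_mul] at ht
    have h2 : ‖(2 : ℚ_[p])‖ ≤ 1 := by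
      simpa using Padic.norm_int_le_one (p := p) 2
    nlinarith [norm_nonneg s]
  have hn : nm x = tr x ^ 2 * (z * (1 - z)) := by
    field_simp at hz'
    linear_combination hz'
  rcases h.mul_eq_zero (sub_mul_sub x (tr x * z) (tr x * (1 - z)) (by ring)
    (by rw [hn]; ring)) with h0 | h0
  · exact scalar _ (sub_eq_zero.1 h0)
  · exact scalar _ (sub_eq_zero.1 h0)

/-- The reduced norm of a division algebra over `ℚ_p` defines an ultrametric absolute value. -/
lemma IsRamifiedOver.norm_nm_add_le (h : IsRamifiedOver ℚ_[p] a b) (x y : ℍ[ℚ_[p], a, b]) :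
    ‖nm (x + y)‖ ≤ max ‖nm x‖ ‖nm y‖ := by
  wlog hle : ‖nm x‖ ≤ ‖nm y‖ generalizing x y
  · rw [add_comm, max_comm]; exact this y x (not_le.1 hle).le
  rcases eq_or_ne y 0 with rfl | hy
  · simp
  obtain ⟨u, rfl⟩ := h y hy
  have hu : 0 < ‖nm (u : ℍ[ℚ_[p], a, b])‖ := norm_pos_iff.2 (nm_unit_ne_zero u)
  set v := x * ((u⁻¹ : (ℍ[ℚ_[p], a, b])ˣ) : ℍ[ℚ_[p], a, b]) with hv
  have hv1 : ‖nm v‖ ≤ 1 := by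
    rw [hv, nm_mul, nm_unit_inv, norm_mul, norm_inv, ← div_eq_mul_inv]
    exact (div_le_one hu).2 hle
  have e : x + u = (1 + v) * u := by rw [add_mul, one_mul, hv, mul_assoc]; simp [add_comm]
  rw [e, nm_mul, norm_mul, max_eq_right hle]
  refine mul_le_of_le_one_left hu.le ?_
  rw [nm_one_add]
  refine (Padic.nonarchimedean _ _).trans (max_le ?_ hv1)
  exact (Padic.nonarchimedean _ _).trans (max_le (by simp) (h.norm_tr_le hv1))

lemma IsRamifiedOver.norm_nm_sub_le (h : IsRamifiedOver ℚ_[p] a b) (x y : ℍ[ℚ_[p], a, b]) :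
    ‖nm (x - y)‖ ≤ max ‖nm x‖ ‖nm y‖ := by
  rw [sub_eq_add_neg, ← nm_neg y]; exact h.norm_nm_add_le x (-y)

/-- The valuation ring `{x : |N(x)| ≤ 1}` of a division algebra over `ℚ_p`. -/
def valRing (h : IsRamifiedOver ℚ_[p] a b) : Subring ℍ[ℚ_[p], a, b] where
  carrier := {x | ‖nm x‖ ≤ 1}
  mul_mem' := fun {x y} hx hy => by
    simp only [Set.mem_ofPred_eq, nm_mul, norm_mul] at *
    exact mul_le_one₀ hx (norm_nonneg _) hy
  one_mem' := by simp
  add_mem' := fun {x y} hx hy => (h.norm_nm_add_le x y).trans (max_le hx hy)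
  zero_mem' := by simp
  neg_mem' := fun {x} hx => by simpa [nm_neg] using hx

/-- The maximal ideal `{x : |N(x)| < 1}` of the valuation ring. -/
def valIdeal (h : IsRamifiedOver ℚ_[p] a b) : Ideal (valRing h) where
  carrier := {x | ‖nm (x : ℍ[ℚ_[p], a, b])‖ < 1}
  add_mem' := fun {x y} hx hy => (h.norm_nm_add_le x y).trans_lt (max_lt hx hy)
  zero_mem' := by simp
  smul_mem' := fun c x hx => by
    simp only [Set.mem_ofPred_eq, smul_eq_mul, Subring.coe_mul, nm_mul, norm_mul] at *
    exact mul_lt_one_of_nonneg_of_lt_one_right c.2 (norm_nonneg _) hx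

lemma mem_valIdeal (h : IsRamifiedOver ℚ_[p] a b) {x : valRing h} :
    x ∈ valIdeal h ↔ ‖nm (x : ℍ[ℚ_[p], a, b])‖ < 1 := Iff.rfl

instance valIdeal_isTwoSided (h : IsRamifiedOver ℚ_[p] a b) : (valIdeal h).IsTwoSided where
  mul_mem_of_left := fun {x} c hx => by
    simp only [mem_valIdeal, Subring.coe_mul, nm_mul, norm_mul] at *
    exact mul_lt_one_of_nonneg_of_lt_one_left (norm_nonneg _) hx c.2

lemma isDomain_residue (h : IsRamifiedOver ℚ_[p] a b) : IsDomain (valRing h ⧸ valIdeal h) := by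
  have : Nontrivial (valRing h ⧸ valIdeal h) := by
    refine ⟨0, 1, fun e => ?_⟩
    have := (Ideal.Quotient.eq_zero_iff_mem (I := valIdeal h) (a := 1)).1 (by simpa using e.symm)
    simp [mem_valIdeal] at this
  have : NoZeroDivisors (valRing h ⧸ valIdeal h) := by
    refine ⟨fun {x y} hxy => ?_⟩
    obtain ⟨x, rfl⟩ := Ideal.Quotient.mk_surjective x
    obtain ⟨y, rfl⟩ := Ideal.Quotient.mk_surjective y
    rw [← map_mul] at hxy
    simp only [Ideal.Quotient.eq_zero_iff_mem, mem_valIdeal, Subring.coe_mul, nm_mul,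
      norm_mul] at *
    by_contra! hc
    nlinarith [hc.1, hc.2]
  exact NoZeroDivisors.to_isDomain _

/-- Wedderburn's little theorem for the residue ring: commutators lie in the maximal ideal. -/
lemma norm_nm_commutator_lt (h : IsRamifiedOver ℚ_[p] a b) [Finite (valRing h ⧸ valIdeal h)]
    {x y : ℍ[ℚ_[p], a, b]} (hx : ‖nm x‖ ≤ 1) (hy : ‖nm y‖ ≤ 1) :
    ‖nm (x * y - y * x)‖ < 1 := by
  have := isDomain_residue h
  have hc := (Finite.isDomain_to_isField (valRing h ⧸ valIdeal h)).mul_comm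
    (Ideal.Quotient.mk _ ⟨x, hx⟩) (Ideal.Quotient.mk _ ⟨y, hy⟩)
  rw [← map_mul, ← map_mul, Ideal.Quotient.mk_eq_mk_iff_sub_mem] at hc
  exact hc

/-- The units of the valuation ring are generated, modulo the maximal ideal, by one element. -/
lemma exists_residue_generator (h : IsRamifiedOver ℚ_[p] a b)
    [Finite (valRing h ⧸ valIdeal h)] :
    ∃ z : ℍ[ℚ_[p], a, b], ‖nm z‖ = 1 ∧
      ∀ x : ℍ[ℚ_[p], a, b], ‖nm x‖ = 1 → ∃ n : ℕ, ‖nm (x - z ^ n)‖ < 1 := by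
  have := isDomain_residue h
  let F := (Finite.isDomain_to_isField (valRing h ⧸ valIdeal h)).toField
  obtain ⟨g, hg⟩ := IsCyclic.exists_monoid_generator (α := (valRing h ⧸ valIdeal h)ˣ)
  obtain ⟨z, hz⟩ := Ideal.Quotient.mk_surjective (g : valRing h ⧸ valIdeal h)
  refine ⟨z, le_antisymm z.2 ?_, fun x hx => ?_⟩
  · by_contra! hc
    have := (Ideal.Quotient.eq_zero_iff_mem (I := valIdeal h)).2 ((mem_valIdeal h).2 hc)
    rw [hz] at this
    exact g.ne_zero this
  · have hx0 : Ideal.Quotient.mk (valIdeal h) ⟨x, hx.le⟩ ≠ 0 := by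
      rw [Ne, Ideal.Quotient.eq_zero_iff_mem, mem_valIdeal]
      simp [hx]
    have hxu : IsUnit (Ideal.Quotient.mk (valIdeal h) ⟨x, hx.le⟩) := by
      obtain ⟨y, hy⟩ := (Finite.isDomain_to_isField (valRing h ⧸ valIdeal h)).mul_inv_cancel hx0
      exact ⟨⟨_, y, hy, by
        rw [(Finite.isDomain_to_isField (valRing h ⧸ valIdeal h)).mul_comm, hy]⟩, rfl⟩
    obtain ⟨u, hu⟩ := hxu
    obtain ⟨n, hn⟩ := (Submonoid.mem_powers_iff _ _).1 (hg u)
    refine ⟨n, ?_⟩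
    have e : Ideal.Quotient.mk (valIdeal h) ⟨x, hx.le⟩ =
        Ideal.Quotient.mk (valIdeal h) (z ^ n) := by
      rw [map_pow, hz, ← hu, ← hn, Units.val_pow_eq_pow_val]
    rw [Ideal.Quotient.mk_eq_mk_iff_sub_mem, mem_valIdeal] at e
    simpa using e

/-- Scaling by powers of `p` normalizes the norm of a nonzero element to `1` or `p⁻¹`. -/
lemma IsRamifiedOver.exists_normalized (h : IsRamifiedOver ℚ_[p] a b) {x : ℍ[ℚ_[p], a, b]}
    (hx : x ≠ 0) : ∃ s : ℚ_[p], ‖nm (algebraMap ℚ_[p] _ s * x)‖ = 1 ∨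
      ‖nm (algebraMap ℚ_[p] _ s * x)‖ = (p : ℝ)⁻¹ := by
  have hp0 : (p : ℝ) ≠ 0 := Nat.cast_ne_zero.2 (Fact.out : p.Prime).ne_zero
  have e := Padic.norm_eq_zpow_neg_valuation (h.nm_ne_zero hx)
  obtain ⟨k, hk⟩ := Int.even_or_odd' (nm x).valuation
  refine ⟨(p : ℚ_[p]) ^ (-k), ?_⟩
  have e2 : ‖nm (algebraMap ℚ_[p] ℍ[ℚ_[p], a, b] ((p : ℚ_[p]) ^ (-k)) * x)‖ =
      (p : ℝ) ^ (2 * k - (nm x).valuation) := by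
    rw [nm_mul, nm_algebraMap, norm_mul, norm_pow, e, Padic.norm_p_zpow, neg_neg,
      ← zpow_natCast, ← zpow_mul, ← zpow_add₀ hp0]
    congr 1
    push_cast
    ring
  rw [e2]
  rcases hk with hk | hk
  · left; rw [hk, sub_self, zpow_zero]
  · right; rw [hk, ← zpow_neg_one]; congr 1; ring

/-- If every norm had even valuation, `i` and `j` could be scaled to units, which commute in the
residue field although `ij = -ji`; so the division algebra has an element of norm `p⁻¹`. -/
lemma IsRamifiedOver.exists_uniformizer (h : IsRamifiedOver ℚ_[p] a b) (hp : 2 < p)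
    [Finite (valRing h ⧸ valIdeal h)] : ∃ x : ℍ[ℚ_[p], a, b], ‖nm x‖ = (p : ℝ)⁻¹ := by
  by_contra! hc
  have hi : (⟨0, 1, 0, 0⟩ : ℍ[ℚ_[p], a, b]) ≠ 0 := fun e => by
    simpa using congrArg QuaternionAlgebra.imI e
  have hj : (⟨0, 0, 1, 0⟩ : ℍ[ℚ_[p], a, b]) ≠ 0 := fun e => by
    simpa using congrArg QuaternionAlgebra.imJ e
  obtain ⟨s, hs⟩ := h.exists_normalized hi
  obtain ⟨t, ht⟩ := h.exists_normalized hj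
  replace hs := hs.resolve_right (hc _)
  replace ht := ht.resolve_right (hc _)
  have hcomm := norm_nm_commutator_lt h hs.le ht.le
  set x := algebraMap ℚ_[p] ℍ[ℚ_[p], a, b] s * ⟨0, 1, 0, 0⟩ with hx
  set y := algebraMap ℚ_[p] ℍ[ℚ_[p], a, b] t * ⟨0, 0, 1, 0⟩ with hy
  have e : x * y - y * x = algebraMap ℚ_[p] _ 2 * (x * y) := by
    ext <;> simp [hx, hy, QuaternionAlgebra.algebraMap_eq]
    ring
  have h2 : ‖(2 : ℚ_[p])‖ = 1 := by
    have := (Padic.norm_natCast_eq_one_iff (p := p) (n := 2)).2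
      ((Nat.coprime_primes (Fact.out : p.Prime) Nat.prime_two).2 hp.ne')
    simpa using this
  rw [e, nm_mul, nm_mul, nm_algebraMap, norm_mul, norm_mul, hs, ht, norm_pow, h2] at hcomm
  norm_num at hcomm

end Division

/-! ### Lattices and their localizations -/

section Lattices

variable {α β : ℚ}

lemma nsmul_cancel {K : Type*} [Field K] [CharZero K] {a b : K} {n : ℕ} (hn : n ≠ 0)
    {x y : ℍ[K, a, b]} (h : n • x = n • y) : x = y := by
  rw [← Nat.cast_smul_eq_nsmul K, ← Nat.cast_smul_eq_nsmul K] at h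
  simpa [smul_smul, hn] using congrArg (fun z => ((n : K)⁻¹) • z) h

lemma toLocal_injective (q : ℕ) [Fact q.Prime] :
    Function.Injective (toLocal q : Quat α β → LQuat α β q) := by
  intro x y h
  have h1 := congrArg QuaternionAlgebra.re h
  have h2 := congrArg QuaternionAlgebra.imI h
  have h3 := congrArg QuaternionAlgebra.imJ h
  have h4 := congrArg QuaternionAlgebra.imK h
  simp only [toLocal, RingHom.coe_mk, MonoidHom.coe_mk, OneHom.coe_mk, Rat.cast_inj] at h1 h2 h3 h4
  ext <;> assumption

lemma nm_toLocal (q : ℕ) [Fact q.Prime] (x : Quat α β) :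
    nm (toLocal q x) = ((nrd x : ℚ) : ℚ_[q]) := by
  change nm (toLocal q x) = ((nm x : ℚ) : ℚ_[q])
  simp [nm_eq, toLocal]

lemma tr_toLocal (q : ℕ) [Fact q.Prime] (x : Quat α β) :
    tr (toLocal q x) = ((trd x : ℚ) : ℚ_[q]) := by
  change tr (toLocal q x) = ((tr x : ℚ) : ℚ_[q])
  simp [tr_eq, toLocal]

lemma toLocal_rat_smul (q : ℕ) [Fact q.Prime] (r : ℚ) (x : Quat α β) :
    toLocal q (r • x) = (r : ℚ_[q]) • toLocal q x := by
  ext <;> simp [toLocal]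

lemma norm_rat_le_one_iff (q : ℕ) [hq : Fact q.Prime] (r : ℚ) :
    ‖(r : ℚ_[q])‖ ≤ 1 ↔ ¬ q ∣ r.den := by
  refine ⟨fun h hd => ?_, Padic.norm_rat_le_one⟩
  have hn : ‖((r.num : ℤ) : ℚ_[q])‖ = 1 := by
    rw [Padic.norm_intCast_eq_one_iff]
    have := Nat.Coprime.of_dvd_right hd r.reduced
    rwa [Int.isCoprime_iff_gcd_eq_one, Int.gcd, Int.natAbs_natCast]
  have e : (r : ℚ_[q]) * (r.den : ℚ_[q]) = ((r.num : ℤ) : ℚ_[q]) := by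
    exact_mod_cast congrArg (fun t : ℚ => (t : ℚ_[q])) (Rat.mul_den_eq_num r)
  have h1 := congrArg norm e
  rw [norm_mul, hn] at h1
  have h2 := Padic.norm_natCast_lt_one_iff.2 hd
  nlinarith [norm_nonneg (r : ℚ_[q]), norm_nonneg (r.den : ℚ_[q])]

lemma exists_int_of_norm_le_one {r : ℚ}
    (h : ∀ (q : ℕ) [Fact q.Prime], ‖(r : ℚ_[q])‖ ≤ 1) : ∃ n : ℤ, (n : ℚ) = r := by
  refine ⟨r.num, Rat.coe_int_num_of_den_eq_one ?_⟩
  by_contra hd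
  obtain ⟨q, hq, hqd⟩ := Nat.exists_prime_and_dvd hd
  have : Fact q.Prime := ⟨hq⟩
  exact (norm_rat_le_one_iff q r).1 (h q) hqd

lemma isUnit_natCast_padicInt {q n : ℕ} [Fact q.Prime] (h : q.Coprime n) :
    IsUnit (n : ℤ_[q]) := by
  rw [PadicInt.isUnit_iff]; exact PadicInt.norm_natCast_eq_one_iff.2 h

/-- A lattice is the `ℤ`-span of a `ℚ`-basis. -/
lemma exists_basis_of_isLat {L : Submodule ℤ (Quat α β)} (hL : IsLat L) :
    ∃ B : Module.Basis (Fin 4) ℚ (Quat α β), L = Submodule.span ℤ (Set.range B) := by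
  have := hL
  let b := Module.Free.chooseBasis ℤ L
  let B := b.extendOfIsLattice ℚ
  have hc : Fintype.card (Module.Free.ChooseBasisIndex ℤ L) = 4 := by
    rw [← Module.finrank_eq_card_basis B]
    exact QuaternionAlgebra.finrank_eq_four _ _ _
  refine ⟨B.reindex (Fintype.equivFinOfCardEq hc), ?_⟩
  rw [Module.Basis.range_reindex]
  have e : Set.range B = L.subtype '' Set.range b := by
    rw [← Set.range_comp]
    congr 1
    ext1 i
    exact b.extendOfIsLattice_apply ℚ i
  rw [e, ← Submodule.map_span, b.span_eq, Submodule.map_top, Submodule.range_subtype]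

/-- The image of a basis of the quaternion algebra in its completion is a basis. -/
def locBasis (q : ℕ) [Fact q.Prime] (B : Module.Basis (Fin 4) ℚ (Quat α β)) :
    Module.Basis (Fin 4) ℚ_[q] (LQuat α β q) :=
  basisOfTopLeSpanOfCardEqFinrank (fun i => toLocal q (B i)) (by
    have key : ∀ x : Quat α β, toLocal q x ∈
        Submodule.span ℚ_[q] (Set.range fun i => toLocal q (B i)) := by
      intro x
      rw [← B.sum_repr x, map_sum]
      refine Submodule.sum_mem _ fun i _ => ?_
      rw [toLocal_rat_smul]
      exact Submodule.smul_mem _ _ (Submodule.subset_span ⟨i, rfl⟩)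
    intro z _
    have e : z = z.re • toLocal q (⟨1, 0, 0, 0⟩ : Quat α β) + z.imI • toLocal q ⟨0, 1, 0, 0⟩ +
        z.imJ • toLocal q ⟨0, 0, 1, 0⟩ + z.imK • toLocal q ⟨0, 0, 0, 1⟩ := by
      ext <;> simp [toLocal]
    rw [e]
    exact Submodule.add_mem _ (Submodule.add_mem _ (Submodule.add_mem _
      (Submodule.smul_mem _ _ (key _)) (Submodule.smul_mem _ _ (key _)))
      (Submodule.smul_mem _ _ (key _))) (Submodule.smul_mem _ _ (key _))) (by
    rw [QuaternionAlgebra.finrank_eq_four]; rfl)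

lemma locBasis_apply (q : ℕ) [Fact q.Prime] (B : Module.Basis (Fin 4) ℚ (Quat α β)) (i : Fin 4) :
    locBasis q B i = toLocal q (B i) := by
  simp [locBasis]

lemma locBasis_repr_toLocal (q : ℕ) [Fact q.Prime] (B : Module.Basis (Fin 4) ℚ (Quat α β))
    (x : Quat α β) (i : Fin 4) :
    (locBasis q B).repr (toLocal q x) i = ((B.repr x i : ℚ) : ℚ_[q]) := by
  have e : toLocal q x = ∑ j, ((B.repr x j : ℚ) : ℚ_[q]) • locBasis q B j := by
    conv_lhs => rw [← B.sum_repr x, map_sum]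
    simp only [toLocal_rat_smul, locBasis_apply]
  rw [e, Module.Basis.repr_sum_self]

lemma loc_mono {q : ℕ} [Fact q.Prime] {L L' : Submodule ℤ (Quat α β)} (h : L ≤ L') :
    loc q L ≤ loc q L' := Submodule.span_mono (Set.image_mono h)

lemma toLocal_mem_loc {q : ℕ} [Fact q.Prime] {L : Submodule ℤ (Quat α β)} {x : Quat α β}
    (h : x ∈ L) : toLocal q x ∈ loc q L := Submodule.subset_span ⟨x, h, rfl⟩

lemma loc_le {q : ℕ} [Fact q.Prime] {L : Submodule ℤ (Quat α β)}
    {M : Submodule ℤ_[q] (LQuat α β q)} (h : ∀ x ∈ L, toLocal q x ∈ M) : loc q L ≤ M :=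
  Submodule.span_le.2 (by rintro _ ⟨x, hx, rfl⟩; exact h x hx)

lemma loc_span_basis (q : ℕ) [Fact q.Prime] (B : Module.Basis (Fin 4) ℚ (Quat α β)) :
    loc q (Submodule.span ℤ (Set.range B)) = Submodule.span ℤ_[q] (Set.range (locBasis q B)) := by
  apply le_antisymm
  · refine loc_le fun x hx => ?_
    induction hx using Submodule.span_induction with
    | mem x h =>
      obtain ⟨i, rfl⟩ := h
      exact Submodule.subset_span ⟨i, locBasis_apply q B i⟩
    | zero => simp
    | add x y _ _ hx hy => rw [map_add]; exact Submodule.add_mem _ hx hy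
    | smul n x _ hx =>
      rw [map_zsmul, ← Int.cast_smul_eq_zsmul ℤ_[q]]
      exact Submodule.smul_mem _ _ hx
  · refine Submodule.span_le.2 ?_
    rintro _ ⟨i, rfl⟩
    rw [locBasis_apply]
    exact toLocal_mem_loc (Submodule.subset_span ⟨i, rfl⟩)

lemma mem_span_basis (B : Module.Basis (Fin 4) ℚ (Quat α β)) (x : Quat α β) :
    x ∈ Submodule.span ℤ (Set.range B) ↔ ∀ i, ∃ n : ℤ, (n : ℚ) = B.repr x i := by
  rw [B.mem_span_iff_repr_mem ℤ]; rfl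

lemma mem_loc_span_basis (q : ℕ) [Fact q.Prime] (B : Module.Basis (Fin 4) ℚ (Quat α β))
    (z : LQuat α β q) :
    z ∈ loc q (Submodule.span ℤ (Set.range B)) ↔ ∀ i, ‖(locBasis q B).repr z i‖ ≤ 1 := by
  rw [loc_span_basis, (locBasis q B).mem_span_iff_repr_mem ℤ_[q]]
  refine forall_congr' fun i => ⟨?_, fun h => ⟨⟨_, h⟩, rfl⟩⟩
  rintro ⟨n, hn⟩
  rw [← hn]
  exact n.2

lemma mem_of_forall_loc {L : Submodule ℤ (Quat α β)} (hL : IsLat L) {x : Quat α β}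
    (h : ∀ (q : ℕ) [Fact q.Prime], toLocal q x ∈ loc q L) : x ∈ L := by
  obtain ⟨B, rfl⟩ := exists_basis_of_isLat hL
  rw [mem_span_basis]
  intro i
  refine exists_int_of_norm_le_one fun q _ => ?_
  have := (mem_loc_span_basis q B _).1 (h q) i
  rwa [locBasis_repr_toLocal] at this

lemma le_of_forall_loc_le {L L' : Submodule ℤ (Quat α β)} (hL' : IsLat L')
    (h : ∀ (q : ℕ) [Fact q.Prime], loc q L ≤ loc q L') : L ≤ L' :=
  fun _ hx => mem_of_forall_loc hL' fun q _ => h q (toLocal_mem_loc hx)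

lemma eq_of_forall_loc_eq {L L' : Submodule ℤ (Quat α β)} (hL : IsLat L) (hL' : IsLat L')
    (h : ∀ (q : ℕ) [Fact q.Prime], loc q L = loc q L') : L = L' :=
  le_antisymm (le_of_forall_loc_le hL' fun q _ => (h q).le)
    (le_of_forall_loc_le hL fun q _ => (h q).ge)

lemma exists_nsmul_mem_of_den {L : Submodule ℤ (Quat α β)}
    {B : Module.Basis (Fin 4) ℚ (Quat α β)} (hB : L = Submodule.span ℤ (Set.range B))
    (x : Quat α β) : (∏ i, (B.repr x i).den) • x ∈ L := by
  subst hB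
  rw [mem_span_basis]
  intro i
  have hd : (B.repr x i).den ∣ ∏ i, (B.repr x i).den :=
    Finset.dvd_prod_of_mem (fun i => (B.repr x i).den) (Finset.mem_univ i)
  obtain ⟨c, hc⟩ := hd
  refine ⟨(B.repr x i).num * c, ?_⟩
  rw [hc, map_nsmul, Finsupp.smul_apply, nsmul_eq_mul]
  push_cast
  rw [← Rat.mul_den_eq_num]
  ring

lemma exists_nsmul_mem {L : Submodule ℤ (Quat α β)} (hL : IsLat L) (x : Quat α β) :
    ∃ n : ℕ, n ≠ 0 ∧ n • x ∈ L := by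
  obtain ⟨B, hB⟩ := exists_basis_of_isLat hL
  exact ⟨_, Finset.prod_ne_zero_iff.2 fun i _ => (B.repr x i).den_ne_zero,
    exists_nsmul_mem_of_den hB x⟩

/-- An element of `L_q` that comes from the global algebra lies in `L` up to a denominator
prime to `q`. -/
lemma exists_coprime_nsmul_mem {q : ℕ} [hq : Fact q.Prime] {L : Submodule ℤ (Quat α β)}
    (hL : IsLat L) {x : Quat α β} (hx : toLocal q x ∈ loc q L) :
    ∃ n : ℕ, q.Coprime n ∧ n • x ∈ L := by
  obtain ⟨B, hB⟩ := exists_basis_of_isLat hL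
  refine ⟨_, Nat.Coprime.prod_right fun i _ => ?_, exists_nsmul_mem_of_den hB x⟩
  rw [hB, mem_loc_span_basis] at hx
  have := hx i
  rw [locBasis_repr_toLocal, norm_rat_le_one_iff] at this
  exact (Nat.Prime.coprime_iff_not_dvd hq.out).2 this

/-- `L` is dense in `L_q`. -/
lemma exists_approx {q : ℕ} [Fact q.Prime] {L : Submodule ℤ (Quat α β)} (n : ℕ)
    {z : LQuat α β q} (hz : z ∈ loc q L) :
    ∃ x ∈ L, ∃ w ∈ loc q L, z = toLocal q x + (q ^ n) • w := by
  induction hz using Submodule.span_induction with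
  | mem z h =>
    obtain ⟨x, hx, rfl⟩ := h
    exact ⟨x, hx, 0, zero_mem _, by simp⟩
  | zero => exact ⟨0, zero_mem _, 0, zero_mem _, by simp⟩
  | add z z' _ _ h h' =>
    obtain ⟨x, hx, w, hw, rfl⟩ := h
    obtain ⟨x', hx', w', hw', rfl⟩ := h'
    exact ⟨x + x', add_mem hx hx', w + w', add_mem hw hw', by rw [map_add, smul_add]; abel⟩
  | smul c z _ h =>
    obtain ⟨x, hx, w, hw, rfl⟩ := h
    obtain ⟨d, hd⟩ : ∃ d : ℤ_[q], c = (c.appr n : ℤ_[q]) + (q : ℤ_[q]) ^ n * d := by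
      obtain ⟨d, hd⟩ := Ideal.mem_span_singleton'.1 (PadicInt.appr_spec n c)
      exact ⟨d, by rw [mul_comm, hd]; ring⟩
    refine ⟨c.appr n • x, L.smul_of_tower_mem _ hx, c • w + d • toLocal q x, add_mem
      (Submodule.smul_mem _ _ hw) (Submodule.smul_mem _ _ (toLocal_mem_loc hx)), ?_⟩
    have e : ((q : ℤ_[q]) ^ n * d) • toLocal q x = (q ^ n) • (d • toLocal q x) := by
      rw [mul_smul, ← Nat.cast_pow, Nat.cast_smul_eq_nsmul]
    rw [smul_add, map_nsmul, smul_add, ← e, smul_comm c (q ^ n) w]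
    nth_rewrite 1 [hd]
    rw [add_smul, Nat.cast_smul_eq_nsmul]
    abel

lemma loc_le_of_nsmul {q n : ℕ} [Fact q.Prime] (hn : q.Coprime n) {L L' : Submodule ℤ (Quat α β)}
    (h : ∀ x ∈ L, n • x ∈ L') : loc q L ≤ loc q L' := by
  refine loc_le fun x hx => ?_
  obtain ⟨u, hu⟩ := isUnit_natCast_padicInt hn
  have h1 := Submodule.smul_mem _ ((u⁻¹ : ℤ_[q]ˣ) : ℤ_[q]) (toLocal_mem_loc (q := q) (h x hx))
  rw [map_nsmul, ← Nat.cast_smul_eq_nsmul ℤ_[q], ← hu, smul_smul, Units.inv_mul, one_smul] at h1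
  exact h1

lemma isLat_of_nsmul {n m : ℕ} (hm : m ≠ 0) {L L' : Submodule ℤ (Quat α β)} (hL : IsLat L)
    (hn0 : n ≠ 0) (h : ∀ x ∈ L, n • x ∈ L') (h' : ∀ x ∈ L', m • x ∈ L) : IsLat L' := by
  have inj : Function.Injective (LinearMap.lsmul ℤ (Quat α β) (m : ℤ)) := by
    intro x y hxy
    exact nsmul_cancel hm (by simpa using hxy)
  refine ⟨?_, ?_⟩
  · have : IsNoetherian ℤ L := isNoetherian_of_isNoetherianRing_of_finite ℤ L
    have hle : L'.map (LinearMap.lsmul ℤ (Quat α β) (m : ℤ)) ≤ L := by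
      rintro _ ⟨x, hx, rfl⟩
      simpa using h' x hx
    have hfg : (L'.map (LinearMap.lsmul ℤ (Quat α β) (m : ℤ))).FG := by
      have := isNoetherian_of_le hle
      exact Module.Finite.iff_fg.1 inferInstance
    exact Submodule.fg_of_fg_map_injective _ inj hfg
  · rw [eq_top_iff, ← hL.span_eq_top]
    refine Submodule.span_le.2 fun x hx => ?_
    have h1 : ((n : ℚ)⁻¹) • (n • x) ∈ Submodule.span ℚ (L' : Set (Quat α β)) :=
      Submodule.smul_mem _ _ (Submodule.subset_span (h x hx))
    rwa [← Nat.cast_smul_eq_nsmul ℚ, smul_smul, inv_mul_cancel₀ (Nat.cast_ne_zero.2 hn0),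
      one_smul] at h1

lemma exists_pow_nsmul_mem_loc {q : ℕ} [hq : Fact q.Prime] {L : Submodule ℤ (Quat α β)}
    (hL : IsLat L) (z : LQuat α β q) : ∃ k : ℕ, q ^ k • z ∈ loc q L := by
  obtain ⟨B, rfl⟩ := exists_basis_of_isLat hL
  have h1 : ∀ i, ∃ k : ℕ, ‖(locBasis q B).repr z i‖ ≤ (q : ℝ) ^ k := fun i =>
    (pow_unbounded_of_one_lt _ (by exact_mod_cast hq.out.one_lt)).imp fun _ h => h.le
  choose k hk using h1
  refine ⟨∑ i, k i, ?_⟩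
  rw [mem_loc_span_basis]
  intro i
  have hq1 : (1 : ℝ) ≤ q := by exact_mod_cast hq.out.one_lt.le
  have hle : (q : ℝ) ^ k i ≤ (q : ℝ) ^ ∑ i, k i :=
    pow_le_pow_right₀ hq1 (Finset.single_le_sum (fun i _ => Nat.zero_le (k i)) (Finset.mem_univ i))
  rw [map_nsmul, Finsupp.smul_apply, nsmul_eq_mul, norm_mul, Nat.cast_pow, norm_pow,
    Padic.norm_p, inv_pow]
  rw [inv_mul_le_one₀ (by positivity)]
  exact (hk i).trans hle

/-- Uniform version: `L₁ g` is contained in a multiple of `L₂` locally. -/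
lemma exists_pow_nsmul_mul_mem {q : ℕ} [hq : Fact q.Prime] {L₁ L₂ : Submodule ℤ (Quat α β)}
    (h₁ : IsLat L₁) (h₂ : IsLat L₂) (g : LQuat α β q) :
    ∃ k₀ : ℕ, ∀ k ≥ k₀, ∀ z ∈ loc q L₁, q ^ k • (z * g) ∈ loc q L₂ := by
  obtain ⟨B, rfl⟩ := exists_basis_of_isLat h₁
  choose k hk using fun i => exists_pow_nsmul_mem_loc h₂ (locBasis q B i * g)
  refine ⟨∑ i, k i, fun n hn z hz => ?_⟩
  rw [loc_span_basis] at hz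
  induction hz using Submodule.span_induction with
  | mem z h =>
    obtain ⟨i, rfl⟩ := h
    have hle : k i ≤ n :=
      (Finset.single_le_sum (fun i _ => Nat.zero_le (k i)) (Finset.mem_univ i)).trans hn
    rw [← Nat.sub_add_cancel hle, pow_add, mul_smul]
    exact Submodule.smul_of_tower_mem _ _ (hk i)
  | zero => simp
  | add x y _ _ hx hy => rw [add_mul, smul_add]; exact add_mem hx hy
  | smul c x _ hx =>
    rw [smul_mul_assoc, smul_comm]
    exact Submodule.smul_mem _ _ hx

/-- The lattice with completion `M` at `p` and the same completions as `L` elsewhere, namely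
`L[1/p] ∩ M`. -/
def glue (p : ℕ) [Fact p.Prime] (L : Submodule ℤ (Quat α β))
    (M : Submodule ℤ_[p] (LQuat α β p)) : Submodule ℤ (Quat α β) where
  carrier := {x | toLocal p x ∈ M ∧ ∃ k : ℕ, p ^ k • x ∈ L}
  add_mem' := by
    rintro x y ⟨hx, k, hk⟩ ⟨hy, l, hl⟩
    refine ⟨by rw [map_add]; exact add_mem hx hy, k + l, ?_⟩
    rw [smul_add]
    refine add_mem ?_ ?_
    · rw [add_comm, pow_add, mul_smul]; exact L.smul_of_tower_mem _ hk
    · rw [pow_add, mul_smul]; exact L.smul_of_tower_mem _ hl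
  zero_mem' := ⟨by simp, 0, by simp⟩
  smul_mem' := by
    rintro c x ⟨hx, k, hk⟩
    refine ⟨?_, k, ?_⟩
    · rw [map_zsmul, ← Int.cast_smul_eq_zsmul ℤ_[p]]; exact M.smul_mem _ hx
    · rw [smul_comm]; exact L.smul_mem c hk

/-- If `M` is commensurable with `L_p` by powers of `p`, then `L[1/p] ∩ M` is a lattice with the
expected completions. -/
lemma glue_spec {p : ℕ} [hp : Fact p.Prime] {L : Submodule ℤ (Quat α β)} (hL : IsLat L)
    {M : Submodule ℤ_[p] (LQuat α β p)} {k : ℕ} (h₁ : ∀ z ∈ loc p L, p ^ k • z ∈ M)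
    (h₂ : ∀ z ∈ M, p ^ k • z ∈ loc p L) :
    IsLat (glue p L M) ∧ loc p (glue p L M) = M ∧
      ∀ (q : ℕ) [Fact q.Prime], q ≠ p → loc q (glue p L M) = loc q L := by
  have hpk : p ^ k ≠ 0 := pow_ne_zero _ hp.out.ne_zero
  have e₁ : ∀ x ∈ L, p ^ k • x ∈ glue p L M := fun x hx =>
    ⟨by rw [map_nsmul (toLocal p)]; exact h₁ _ (toLocal_mem_loc hx), 0, by
      simpa using L.smul_of_tower_mem (p ^ k) hx⟩
  have e₂ : ∀ x ∈ glue p L M, p ^ k • x ∈ L := by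
    rintro x ⟨hx, l, hl⟩
    obtain ⟨n, hn, hnx⟩ := exists_coprime_nsmul_mem (q := p) (x := p ^ k • x) hL
      (by rw [map_nsmul]; exact h₂ _ hx)
    -- `p ^ k • x` is killed into `L` by the coprime numbers `n` and `p ^ l`.
    have hc : IsCoprime (n : ℤ) ((p ^ l : ℕ) : ℤ) :=
      Nat.isCoprime_iff_coprime.2 (Nat.Coprime.pow_right l hn.symm)
    obtain ⟨u, v, huv⟩ := hc
    have h3 : p ^ l • p ^ k • x ∈ L := by rw [smul_comm]; exact L.smul_of_tower_mem _ hl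
    have : u • (n • p ^ k • x) + v • (p ^ l • p ^ k • x) = p ^ k • x := by
      rw [← natCast_zsmul _ n, ← natCast_zsmul (p ^ k • x) (p ^ l), smul_smul, smul_smul,
        ← add_smul, huv, one_smul]
    rw [← this]
    exact add_mem (L.smul_mem _ hnx) (L.smul_mem _ h3)
  refine ⟨isLat_of_nsmul hpk hL hpk e₁ e₂, ?_, fun q hq hqp => ?_⟩
  · refine le_antisymm (loc_le fun x hx => hx.1) fun m hm => ?_
    obtain ⟨x, hx, w, hw, e⟩ := exists_approx (k + k) (h₂ m hm)
    -- Divide the approximation `x` of `p ^ k • m` by `p ^ k`.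
    set y : Quat α β := ((p ^ k : ℕ) : ℚ)⁻¹ • x with hy
    have hyx : p ^ k • y = x := by
      rw [hy, ← Nat.cast_smul_eq_nsmul ℚ, smul_smul, mul_inv_cancel₀ (Nat.cast_ne_zero.2 hpk),
        one_smul]
    have hmy : m = toLocal p y + p ^ k • w := by
      rw [← hyx, map_nsmul, pow_add, mul_smul, ← smul_add] at e
      exact nsmul_cancel hpk e
    have hwM : p ^ k • w ∈ M := h₁ w hw
    have hyM : toLocal p y ∈ M := by
      rw [eq_sub_of_add_eq hmy.symm]; exact sub_mem hm hwM
    rw [hmy]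
    refine add_mem (toLocal_mem_loc ⟨hyM, k, by rwa [hyx]⟩) ?_
    have : ∀ w ∈ loc p L, p ^ k • w ∈ loc p (glue p L M) := by
      intro w hw
      induction hw using Submodule.span_induction with
      | mem z h =>
        obtain ⟨x, hx, rfl⟩ := h
        rw [← map_nsmul (toLocal p)]
        exact toLocal_mem_loc (e₁ x hx)
      | zero => simp
      | add x y _ _ hx hy => rw [smul_add]; exact add_mem hx hy
      | smul c x _ hx => rw [smul_comm]; exact Submodule.smul_mem _ _ hx
    exact this w hw
  · have hc : q.Coprime (p ^ k) :=
      Nat.Coprime.pow_right _ ((Nat.coprime_primes hq.out hp.out).2 hqp)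
    exact le_antisymm (loc_le_of_nsmul hc e₂) (loc_le_of_nsmul hc e₁)

lemma mem_locRmul {q : ℕ} [Fact q.Prime] {M : Submodule ℤ_[q] (LQuat α β q)}
    (x : (LQuat α β q)ˣ) {z : LQuat α β q} :
    z ∈ locRmul M x ↔ z * ((x⁻¹ : (LQuat α β q)ˣ) : LQuat α β q) ∈ M := by
  constructor
  · rintro ⟨y, hy, rfl⟩
    simpa using hy
  · intro h
    exact ⟨_, h, by simp⟩

lemma locRmul_mul {q : ℕ} [Fact q.Prime] (M : Submodule ℤ_[q] (LQuat α β q))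
    (x y : LQuat α β q) : locRmul (locRmul M x) y = locRmul M (x * y) := by
  rw [locRmul, locRmul, locRmul, ← Submodule.map_comp]
  congr 1
  ext1 z
  simp [mul_assoc]

lemma locRmul_one {q : ℕ} [Fact q.Prime] (M : Submodule ℤ_[q] (LQuat α β q)) :
    locRmul M 1 = M := by
  ext z; simp [locRmul]

lemma locRmul_mono {q : ℕ} [Fact q.Prime] {M N : Submodule ℤ_[q] (LQuat α β q)}
    (h : M ≤ N) (x : LQuat α β q) : locRmul M x ≤ locRmul N x := Submodule.map_mono h

/-- There is a lattice with a prescribed completion at `p` and the completions of `L`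
elsewhere. -/
lemma exists_lat_of_loc (p : ℕ) [hp : Fact p.Prime] {L N : Submodule ℤ (Quat α β)} (hL : IsLat L)
    (hN : IsLat N) (g : (LQuat α β p)ˣ) :
    ∃ L' : Submodule ℤ (Quat α β), IsLat L' ∧ loc p L' = locRmul (loc p N) g ∧
      ∀ (q : ℕ) [Fact q.Prime], q ≠ p → loc q L' = loc q L := by
  obtain ⟨k₁, h₁⟩ := exists_pow_nsmul_mul_mem hN hL (g : LQuat α β p)
  obtain ⟨k₂, h₂⟩ := exists_pow_nsmul_mul_mem hL hN ((g⁻¹ : (LQuat α β p)ˣ) : LQuat α β p)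
  refine ⟨_, glue_spec hL (M := locRmul (loc p N) g) (k := k₁ + k₂) (fun z hz => ?_) ?_⟩
  · rw [mem_locRmul, smul_mul_assoc]
    exact h₂ _ (by omega) z hz
  · rintro _ ⟨z, hz, rfl⟩
    exact h₁ _ (by omega) z hz

lemma loc_rmul (q : ℕ) [Fact q.Prime] (L : Submodule ℤ (Quat α β)) (x : Quat α β) :
    loc q (rmul L x) = locRmul (loc q L) (toLocal q x) := by
  rw [locRmul, loc, loc, Submodule.map_span]
  congr 1
  ext z
  constructor
  · rintro ⟨_, ⟨y, hy, rfl⟩, rfl⟩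
    exact ⟨_, ⟨y, hy, rfl⟩, by simp⟩
  · rintro ⟨_, ⟨y, hy, rfl⟩, rfl⟩
    exact ⟨y * x, ⟨y, hy, rfl⟩, by simp⟩

lemma mem_rmul {L : Submodule ℤ (Quat α β)} (x : (Quat α β)ˣ) {z : Quat α β} :
    z ∈ rmul L x ↔ z * ((x⁻¹ : (Quat α β)ˣ) : Quat α β) ∈ L := by
  constructor
  · rintro ⟨y, hy, rfl⟩
    simpa using hy
  · intro h
    exact ⟨_, h, by simp⟩

lemma rmul_rmul (L : Submodule ℤ (Quat α β)) (x y : Quat α β) :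
    rmul (rmul L x) y = rmul L (x * y) := by
  rw [rmul, rmul, rmul, ← Submodule.map_comp]
  congr 1
  ext1 z
  simp [mul_assoc]

lemma rmul_one (L : Submodule ℤ (Quat α β)) : rmul L 1 = L := by
  ext z; simp [rmul]

lemma isLat_rmul {L : Submodule ℤ (Quat α β)} (hL : IsLat L) (x : (Quat α β)ˣ) :
    IsLat (rmul L x) := by
  refine ⟨hL.fg.map _, ?_⟩
  rw [eq_top_iff]
  intro z _
  have hz : z * ((x⁻¹ : (Quat α β)ˣ) : Quat α β) ∈ Submodule.span ℚ (L : Set (Quat α β)) := by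
    rw [hL.span_eq_top]; trivial
  have h1 := Submodule.mem_map_of_mem (f := LinearMap.mulRight ℚ (x : Quat α β)) hz
  rw [Submodule.map_span] at h1
  rw [LinearMap.mulRight_apply, mul_assoc, Units.inv_mul, mul_one] at h1
  exact h1

end Lattices

/-! ### Norms of lattices -/

section Norms

variable {α β : ℚ}

lemma padicInt_smul_eq {q : ℕ} [Fact q.Prime] (c : ℤ_[q]) (z : LQuat α β q) :
    c • z = algebraMap ℚ_[q] _ (c : ℚ_[q]) * z := by
  rw [← Algebra.smul_def]; rfl

lemma tr_algebraMap_mul {K : Type*} [Field K] {a b : K} (r : K) (z : ℍ[K, a, b]) :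
    tr (algebraMap K _ r * z) = r * tr z := by
  simp [tr_eq, QuaternionAlgebra.algebraMap_eq]; ring

/-- The reduced norms of the elements of a lattice have a common denominator, so that they
generate a cyclic group. -/
lemma exists_common_denominator {L : Submodule ℤ (Quat α β)} (hL : IsLat L) :
    ∃ d : ℕ, d ≠ 0 ∧ ∀ x ∈ L, ∃ m : ℤ, (m : ℚ) = d * nrd x := by
  obtain ⟨B, rfl⟩ := exists_basis_of_isLat hL
  set C := QuaternionAlgebra.basisOneIJK α 0 β
  have hC : IsLat (Submodule.span ℤ (Set.range C)) := by
    refine ⟨Submodule.fg_span (Set.finite_range C), ?_⟩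
    rw [eq_top_iff, ← C.span_eq]
    exact Submodule.span_mono Submodule.subset_span
  choose n hn0 hn using fun i => exists_nsmul_mem hC (B i)
  set e := ∏ i, n i
  have he : ∀ x ∈ Submodule.span ℤ (Set.range B), e • x ∈ Submodule.span ℤ (Set.range C) := by
    intro x hx
    induction hx using Submodule.span_induction with
    | mem x h =>
      obtain ⟨i, rfl⟩ := h
      obtain ⟨c, hc⟩ : n i ∣ e := Finset.dvd_prod_of_mem n (Finset.mem_univ i)
      rw [hc, mul_comm, mul_smul]
      exact Submodule.smul_of_tower_mem _ _ (hn i)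
    | zero => simp
    | add x y _ _ hx hy => rw [smul_add]; exact add_mem hx hy
    | smul c x _ hx => rw [smul_comm]; exact Submodule.smul_mem _ _ hx
  refine ⟨e ^ 2 * (α.den * β.den), mul_ne_zero (pow_ne_zero _
    (Finset.prod_ne_zero_iff.2 fun i _ => hn0 i)) (mul_ne_zero α.den_ne_zero β.den_ne_zero),
    fun x hx => ?_⟩
  have h4 := (mem_span_basis C _).1 (he x hx)
  obtain ⟨r, hr⟩ := h4 0
  obtain ⟨s, hs⟩ := h4 1
  obtain ⟨t, ht⟩ := h4 2
  obtain ⟨u, hu⟩ := h4 3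
  simp only [C, QuaternionAlgebra.coe_basisOneIJK_repr] at hr hs ht hu
  simp at hr hs ht hu
  refine ⟨r ^ 2 * α.den * β.den - α.num * s ^ 2 * β.den - β.num * t ^ 2 * α.den +
    α.num * β.num * u ^ 2, ?_⟩
  have hα := Rat.mul_den_eq_num α
  have hβ := Rat.mul_den_eq_num β
  push_cast
  rw [hr, hs, ht, hu, ← hα, ← hβ]
  change _ = _ * nm x
  rw [nm_eq]
  ring

lemma exists_isRatGcd {L : Submodule ℤ (Quat α β)} (hL : IsLat L) :
    ∃ n, IsRatGcd (nrd '' (L : Set (Quat α β))) n := by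
  obtain ⟨d, hd0, hd⟩ := exists_common_denominator hL
  have hdQ : (d : ℚ) ≠ 0 := Nat.cast_ne_zero.2 hd0
  set F := Submodule.span ℤ (nrd '' (L : Set (Quat α β)))
  let φ : ℤ →ₗ[ℤ] ℚ := LinearMap.toSpanSingleton ℤ ℚ (d : ℚ)⁻¹
  have hφ : ∀ m : ℤ, φ m = m * (d : ℚ)⁻¹ := fun m => by simp [φ]
  obtain ⟨g, hg⟩ := (IsPrincipalIdealRing.principal (F.comap φ)).principal
  have hF : F = (F.comap φ).map φ := by
    rw [Submodule.map_comap_eq, eq_comm, inf_eq_right]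
    refine Submodule.span_le.2 ?_
    rintro _ ⟨x, hx, rfl⟩
    obtain ⟨m, hm⟩ := hd x hx
    exact ⟨m, by rw [hφ, hm]; field_simp⟩
  have hF' : F = Submodule.span ℤ {φ g} := by
    rw [hF, hg, Submodule.map_span, Set.image_singleton]
  rcases le_total 0 (φ g) with h | h
  · exact ⟨φ g, h, hF'⟩
  · refine ⟨-φ g, neg_nonneg.2 h, ?_⟩
    rw [← Set.neg_singleton, Submodule.span_neg]
    exact hF'

lemma latNorm_spec {L : Submodule ℤ (Quat α β)} (hL : IsLat L) :
    IsRatGcd (nrd '' (L : Set (Quat α β))) (latNorm L) := by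
  rw [latNorm, dif_pos (exists_isRatGcd hL)]
  exact (exists_isRatGcd hL).choose_spec

lemma norm_nrd_le {q : ℕ} [Fact q.Prime] {L : Submodule ℤ (Quat α β)} (hL : IsLat L)
    {x : Quat α β} (hx : x ∈ L) : ‖((nrd x : ℚ) : ℚ_[q])‖ ≤ ‖((latNorm L : ℚ) : ℚ_[q])‖ := by
  have h : nrd x ∈ Submodule.span ℤ {latNorm L} := by
    rw [← (latNorm_spec hL).2]; exact Submodule.subset_span ⟨x, hx, rfl⟩
  obtain ⟨m, hm⟩ := Submodule.mem_span_singleton.1 h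
  rw [← hm, zsmul_eq_mul, Rat.cast_mul, norm_mul, Rat.cast_intCast]
  exact mul_le_of_le_one_left (norm_nonneg _) (Padic.norm_int_le_one m)

lemma norm_tr_mul_star_le {q : ℕ} [Fact q.Prime] {L : Submodule ℤ (Quat α β)} (hL : IsLat L)
    {z w : LQuat α β q} (hz : z ∈ loc q L) (hw : w ∈ loc q L) :
    ‖tr (z * star w)‖ ≤ ‖((latNorm L : ℚ) : ℚ_[q])‖ := by
  induction hz using Submodule.span_induction with
  | mem z h =>
    obtain ⟨x, hx, rfl⟩ := h
    induction hw using Submodule.span_induction with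
    | mem w h =>
      obtain ⟨y, hy, rfl⟩ := h
      have e : tr (toLocal q x * star (toLocal q y)) = ((nrd (x + y) : ℚ) : ℚ_[q]) -
          ((nrd x : ℚ) : ℚ_[q]) - ((nrd y : ℚ) : ℚ_[q]) := by
        rw [← nm_toLocal, ← nm_toLocal, ← nm_toLocal, map_add, nm_add]; ring
      rw [e, sub_eq_add_neg, sub_eq_add_neg]
      refine (Padic.nonarchimedean _ _).trans (max_le ((Padic.nonarchimedean _ _).trans
        (max_le (norm_nrd_le hL (add_mem hx hy)) ?_)) ?_)
      · rw [norm_neg]; exact norm_nrd_le hL hx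
      · rw [norm_neg]; exact norm_nrd_le hL hy
    | zero => simp [tr_eq, -Padic.eq_padicNorm]
    | add w w' _ _ h h' =>
      rw [star_add, mul_add, tr_add]
      exact (Padic.nonarchimedean _ _).trans (max_le h h')
    | smul c w _ h =>
      have e : tr (toLocal q x * star (c • w)) = c * tr (toLocal q x * star w) := by
        rw [QuaternionAlgebra.star_smul', mul_smul_comm, padicInt_smul_eq, tr_algebraMap_mul]
      rw [e, norm_mul]
      exact (mul_le_of_le_one_left (norm_nonneg _) c.2).trans h
  | zero => simp [tr_eq, -Padic.eq_padicNorm]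
  | add z z' _ _ h h' =>
    rw [add_mul, tr_add]
    exact (Padic.nonarchimedean _ _).trans (max_le h h')
  | smul c z _ h =>
    have e : tr (c • z * star w) = c * tr (z * star w) := by
      rw [smul_mul_assoc, padicInt_smul_eq, tr_algebraMap_mul]
    rw [e, norm_mul]
    exact (mul_le_of_le_one_left (norm_nonneg _) c.2).trans h

lemma nm_padicInt_smul {q : ℕ} [Fact q.Prime] (c : ℤ_[q]) (z : LQuat α β q) :
    nm (c • z) = (c : ℚ_[q]) ^ 2 * nm z := by
  rw [padicInt_smul_eq, nm_mul, nm_algebraMap]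

lemma norm_nm_le {q : ℕ} [Fact q.Prime] {L : Submodule ℤ (Quat α β)} (hL : IsLat L)
    {z : LQuat α β q} (hz : z ∈ loc q L) : ‖nm z‖ ≤ ‖((latNorm L : ℚ) : ℚ_[q])‖ := by
  induction hz using Submodule.span_induction with
  | mem z h =>
    obtain ⟨x, hx, rfl⟩ := h
    rw [nm_toLocal]
    exact norm_nrd_le hL hx
  | zero => simp [-Padic.eq_padicNorm]
  | add z z' hz hz' h h' =>
    rw [nm_add]
    exact (Padic.nonarchimedean _ _).trans (max_le ((Padic.nonarchimedean _ _).trans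
      (max_le h h')) (norm_tr_mul_star_le hL hz hz'))
  | smul c z _ h =>
    rw [nm_padicInt_smul, norm_mul, norm_pow]
    exact (mul_le_of_le_one_left (norm_nonneg _) (pow_le_one₀ (norm_nonneg _) c.2)).trans h

lemma exists_norm_nrd_eq {q : ℕ} [Fact q.Prime] {L : Submodule ℤ (Quat α β)} (hL : IsLat L) :
    ∃ x ∈ L, ‖((latNorm L : ℚ) : ℚ_[q])‖ ≤ ‖((nrd x : ℚ) : ℚ_[q])‖ := by
  by_contra! hc
  have h : latNorm L ∈ Submodule.span ℤ (nrd '' (L : Set (Quat α β))) := by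
    rw [(latNorm_spec hL).2]; exact Submodule.mem_span_singleton_self _
  have key : ∀ y ∈ Submodule.span ℤ (nrd '' (L : Set (Quat α β))),
      ‖((y : ℚ) : ℚ_[q])‖ < ‖((latNorm L : ℚ) : ℚ_[q])‖ := by
    intro y hy
    induction hy using Submodule.span_induction with
    | mem y h => obtain ⟨x, hx, rfl⟩ := h; exact hc x hx
    | zero => simpa using (norm_nonneg _).trans_lt (hc 0 L.zero_mem)
    | add y y' _ _ h h' =>
      rw [Rat.cast_add]; exact (Padic.nonarchimedean _ _).trans_lt (max_lt h h')
    | smul c y _ h =>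
      rw [zsmul_eq_mul, Rat.cast_mul, norm_mul, Rat.cast_intCast]
      exact (mul_le_of_le_one_left (norm_nonneg _) (Padic.norm_int_le_one c)).trans_lt h
  exact lt_irrefl _ (key _ h)

lemma eq_of_forall_norm_eq {r s : ℚ} (hr : 0 ≤ r) (hs : 0 ≤ s)
    (h : ∀ (q : ℕ) [Fact q.Prime], ‖(r : ℚ_[q])‖ = ‖(s : ℚ_[q])‖) : r = s := by
  have h2 : Fact (Nat.Prime 2) := ⟨Nat.prime_two⟩
  rcases eq_or_ne s 0 with rfl | hs0
  · have := h 2; simpa [-Padic.eq_padicNorm] using this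
  have hr0 : r ≠ 0 := by
    rintro rfl
    have := h 2
    exact hs0 (by simpa [-Padic.eq_padicNorm] using this.symm)
  have key : ∀ {r s : ℚ}, 0 ≤ r → 0 ≤ s → s ≠ 0 → r ≠ 0 →
      (∀ (q : ℕ) [Fact q.Prime], ‖(r : ℚ_[q])‖ = ‖(s : ℚ_[q])‖) → s ≤ r := by
    intro r s hr hs hs0 hr0 h
    obtain ⟨n, hn⟩ := exists_int_of_norm_le_one (r := r / s) fun q _ => by
      rw [Rat.cast_div, norm_div, h q]; exact div_self_le_one _
    have hpos : 0 < r / s := div_pos (lt_of_le_of_ne hr hr0.symm) (lt_of_le_of_ne hs hs0.symm)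
    have h1 : (1 : ℚ) ≤ r / s := by
      rw [← hn] at hpos ⊢
      have : 0 < n := by exact_mod_cast hpos
      exact_mod_cast this
    rwa [le_div_iff₀ (lt_of_le_of_ne hs hs0.symm), one_mul] at h1
  exact le_antisymm (key hs hr hr0 hs0 fun q _ => (h q).symm) (key hr hs hs0 hr0 h)

/-! ### Local orders -/

section Orders

variable {R : Subring (Quat α β)} {q : ℕ} [Fact q.Prime]

lemma pow_mem_locOrd {z : LQuat α β q} (hz : z ∈ locOrd q R) (n : ℕ) : z ^ n ∈ locOrd q R := by
  induction n with
  | zero => simpa using one_mem_locOrd q R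
  | succ n ih => rw [pow_succ]; exact mul_mem_locOrd ih hz

/-- Reduced norms of local orders are integral, because the powers of an element have bounded
norm. -/
lemma norm_nm_le_one (hR : IsOrder R) {z : LQuat α β q} (hz : z ∈ locOrd q R) : ‖nm z‖ ≤ 1 := by
  by_contra! hc
  obtain ⟨n, hn⟩ := pow_unbounded_of_one_lt ‖((latNorm (asLat R) : ℚ) : ℚ_[q])‖ hc
  have := norm_nm_le hR (pow_mem_locOrd hz n)
  rw [nm_pow, norm_pow] at this
  exact absurd this (not_le.2 hn)

lemma norm_tr_le_one (hR : IsOrder R) {z : LQuat α β q} (hz : z ∈ locOrd q R) : ‖tr z‖ ≤ 1 := by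
  have e : tr z = nm (1 + z) + -(1 : ℚ_[q]) + -nm z := by rw [nm_one_add]; ring
  rw [e]
  refine (Padic.nonarchimedean _ _).trans (max_le ((Padic.nonarchimedean _ _).trans
    (max_le (norm_nm_le_one hR (add_mem (one_mem_locOrd q R) hz)) (by simp))) ?_)
  rw [norm_neg]
  exact norm_nm_le_one hR hz

lemma algebraMap_mul_mem_locOrd {r : ℚ_[q]} (hr : ‖r‖ ≤ 1) {z : LQuat α β q}
    (hz : z ∈ locOrd q R) : algebraMap ℚ_[q] _ r * z ∈ locOrd q R := by
  obtain ⟨c, rfl⟩ : ∃ c : ℤ_[q], (c : ℚ_[q]) = r := ⟨⟨r, hr⟩, rfl⟩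
  rw [← padicInt_smul_eq]
  exact Submodule.smul_mem _ c hz

lemma algebraMap_mem_locOrd {r : ℚ_[q]} (hr : ‖r‖ ≤ 1) :
    (algebraMap ℚ_[q] _ r : LQuat α β q) ∈ locOrd q R := by
  simpa using algebraMap_mul_mem_locOrd hr (one_mem_locOrd q R)

lemma star_mem_locOrd (hR : IsOrder R) {z : LQuat α β q} (hz : z ∈ locOrd q R) :
    star z ∈ locOrd q R := by
  rw [star_eq]
  exact sub_mem (algebraMap_mem_locOrd (norm_tr_le_one hR hz)) hz

/-- An element of a local order is a unit when its reduced norm is one. -/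
lemma mem_locUnits_iff (hR : IsOrder R) (u : (LQuat α β q)ˣ) :
    u ∈ locUnits q R ↔ (u : LQuat α β q) ∈ locOrd q R ∧ ‖nm (u : LQuat α β q)‖ = 1 := by
  refine ⟨fun h => ⟨h.1, le_antisymm (norm_nm_le_one hR h.1) ?_⟩, fun h => ⟨h.1, ?_⟩⟩
  · have h1 := norm_nm_le_one hR h.2
    rw [nm_unit_inv, norm_inv] at h1
    exact (inv_le_one₀ (norm_pos_iff.2 (nm_unit_ne_zero u))).1 h1
  · rw [unit_inv_eq]
    exact algebraMap_mul_mem_locOrd (by rw [norm_inv, h.2, inv_one]) (star_mem_locOrd hR h.1)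

lemma locRmul_unit {u : (LQuat α β q)ˣ} (hu : u ∈ locUnits q R) :
    locRmul (locOrd q R) u = locOrd q R := by
  ext z
  rw [mem_locRmul]
  refine ⟨fun h => ?_, fun h => mul_mem_locOrd h hu.2⟩
  simpa using mul_mem_locOrd h hu.1

/-- Two generators of a principal local ideal differ by a unit. -/
lemma locRmul_eq_iff (x y : (LQuat α β q)ˣ) :
    locRmul (locOrd q R) x = locRmul (locOrd q R) y ↔ x * y⁻¹ ∈ locUnits q R := by
  constructor
  · intro h
    constructor
    · have : (x : LQuat α β q) ∈ locRmul (locOrd q R) y := by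
        rw [← h, mem_locRmul]; simpa using one_mem_locOrd q R
      simpa [mem_locRmul] using this
    · have : (y : LQuat α β q) ∈ locRmul (locOrd q R) x := by
        rw [h, mem_locRmul]; simpa using one_mem_locOrd q R
      simpa [mem_locRmul] using this
  · intro h
    have e : (x : LQuat α β q) = ((x * y⁻¹ : (LQuat α β q)ˣ) : LQuat α β q) * y := by simp
    rw [e, ← locRmul_mul, locRmul_unit h]

/-- The norm of a locally principal lattice is, up to a unit at `q`, the reduced norm of a local
generator. -/
lemma norm_latNorm (hR : IsOrder R) {a : Submodule ℤ (Quat α β)} (ha : IsLat a)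
    {x : (LQuat α β q)ˣ} (hx : loc q a = locRmul (locOrd q R) x) :
    ‖((latNorm a : ℚ) : ℚ_[q])‖ = ‖nm (x : LQuat α β q)‖ := by
  apply le_antisymm
  · obtain ⟨y, hy, h⟩ := exists_norm_nrd_eq (q := q) ha
    refine h.trans ?_
    have h1 := toLocal_mem_loc (q := q) hy
    rw [hx] at h1
    obtain ⟨r, hr, hr'⟩ := h1
    rw [← nm_toLocal, ← hr', LinearMap.mulRight_apply, nm_mul, norm_mul]
    exact mul_le_of_le_one_left (norm_nonneg _) (norm_nm_le_one hR hr)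
  · refine norm_nm_le ha ?_
    rw [hx, mem_locRmul]
    simpa using one_mem_locOrd q R

end Orders
end Norms

/-! ### Subideals of the same norm -/

section Subideals

variable {α β : ℚ}

/-- A pair of orders `R' ⊆ R` which agree at all primes other than `p`. -/
structure AgreeAwayFrom (p : ℕ) [Fact p.Prime] (R R' : Subring (Quat α β)) : Prop where
  order : IsOrder R
  order' : IsOrder R'
  le : R' ≤ R
  loc_eq : ∀ (q : ℕ) [Fact q.Prime], q ≠ p → locOrd q R' = locOrd q R

variable {p : ℕ} [Fact p.Prime] {R R' : Subring (Quat α β)}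

lemma AgreeAwayFrom.locOrd_le (h : AgreeAwayFrom p R R') : locOrd p R' ≤ locOrd p R :=
  loc_mono h.le

lemma AgreeAwayFrom.locUnits_le (h : AgreeAwayFrom p R R') : locUnits p R' ≤ locUnits p R :=
  fun _ hu => ⟨h.locOrd_le hu.1, h.locOrd_le hu.2⟩

lemma generator_mem {q : ℕ} [Fact q.Prime] (R : Subring (Quat α β)) (x : (LQuat α β q)ˣ) :
    (x : LQuat α β q) ∈ locRmul (locOrd q R) x := by
  rw [mem_locRmul]; simpa using one_mem_locOrd q R

/-- Local description of the subideals of `a` with the same norm: they agree with `a` away from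
`p`, and at `p` their generators differ from that of `a` by units of `R_p`. -/
lemma AgreeAwayFrom.mem_Psi_iff (h : AgreeAwayFrom p R R') {a : Submodule ℤ (Quat α β)}
    (ha : a ∈ leftIdeals R) {y : (LQuat α β p)ˣ} (hy : loc p a = locRmul (locOrd p R) y)
    (b : Submodule ℤ (Quat α β)) :
    b ∈ Psi R' a ↔ IsLat b ∧ (∀ (q : ℕ) [Fact q.Prime], q ≠ p → loc q b = loc q a) ∧
      ∃ u ∈ locUnits p R,
        loc p b = locRmul (locOrd p R') ((u * y : (LQuat α β p)ˣ) : LQuat α β p) := by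
  constructor
  · rintro ⟨⟨hb, hbl⟩, hba, hn⟩
    have key : ∀ (q : ℕ) [Fact q.Prime] (x y : (LQuat α β q)ˣ),
        loc q b = locRmul (locOrd q R') x → loc q a = locRmul (locOrd q R) y →
        x * y⁻¹ ∈ locUnits q R := by
      intro q _ x y hx hy
      rw [mem_locUnits_iff h.order]
      constructor
      · have h1 : (x : LQuat α β q) ∈ loc q a := by
          refine loc_mono hba ?_
          rw [hx]; exact generator_mem _ _
        rw [hy, mem_locRmul] at h1
        exact h1
      · rw [Units.val_mul, nm_mul, nm_unit_inv, norm_mul, norm_inv,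
          ← norm_latNorm h.order' hb hx, ← norm_latNorm h.order ha.1 hy, hn]
        refine mul_inv_cancel₀ ?_
        rw [norm_latNorm h.order ha.1 hy]
        exact norm_ne_zero_iff.2 (nm_unit_ne_zero _)
    refine ⟨hb, fun q _ hq => ?_, ?_⟩
    · obtain ⟨x, hx⟩ := hbl q
      obtain ⟨z, hz⟩ := ha.2 q
      have := key q x z hx hz
      rw [hx, hz, h.loc_eq q hq, locRmul_eq_iff]
      exact this
    · obtain ⟨x, hx⟩ := hbl p
      exact ⟨x * y⁻¹, key p x y hx hy, by rw [hx]; simp⟩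
  · rintro ⟨hb, hq, u, hu, hbu⟩
    refine ⟨⟨hb, fun q _ => ?_⟩, le_of_forall_loc_le ha.1 fun q _ => ?_,
      eq_of_forall_norm_eq (latNorm_spec hb).1 (latNorm_spec ha.1).1 fun q _ => ?_⟩
    · rcases eq_or_ne q p with rfl | hqp
      · exact ⟨_, hbu⟩
      · obtain ⟨x, hx⟩ := ha.2 q
        exact ⟨x, by rw [hq q hqp, hx, h.loc_eq q hqp]⟩
    · rcases eq_or_ne q p with rfl | hqp
      · rw [hbu, hy, Units.val_mul, ← locRmul_mul]
        refine locRmul_mono ?_ _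
        rw [← locRmul_unit hu]
        exact locRmul_mono h.locOrd_le _
      · exact (hq q hqp).le
    · rcases eq_or_ne q p with rfl | hqp
      · rw [norm_latNorm h.order' hb hbu, norm_latNorm h.order ha.1 hy, Units.val_mul, nm_mul,
          norm_mul, ((mem_locUnits_iff h.order u).1 hu).2, one_mul]
      · obtain ⟨x, hx⟩ := ha.2 q
        rw [norm_latNorm h.order ha.1 hx, norm_latNorm h.order' hb
          (by rw [hq q hqp, hx, h.loc_eq q hqp])]

lemma AgreeAwayFrom.exists_mem_Psi (h : AgreeAwayFrom p R R') {a : Submodule ℤ (Quat α β)}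
    (ha : a ∈ leftIdeals R) {y : (LQuat α β p)ˣ} (hy : loc p a = locRmul (locOrd p R) y)
    {u : (LQuat α β p)ˣ} (hu : u ∈ locUnits p R) :
    ∃ b ∈ Psi R' a, loc p b = locRmul (locOrd p R') ((u * y : (LQuat α β p)ˣ) : LQuat α β p) := by
  obtain ⟨b, hb, hbp, hbq⟩ := exists_lat_of_loc p ha.1 h.order' (u * y)
  exact ⟨b, (h.mem_Psi_iff ha hy b).2 ⟨hb, hbq, u, hu, hbp⟩, hbp⟩

lemma AgreeAwayFrom.loc_eq_of_mem_Psi (h : AgreeAwayFrom p R R') {a b : Submodule ℤ (Quat α β)}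
    (ha : a ∈ leftIdeals R) (hb : b ∈ Psi R' a) (q : ℕ) [Fact q.Prime] (hq : q ≠ p) :
    loc q b = loc q a := by
  obtain ⟨y, hy⟩ := ha.2 p
  exact ((h.mem_Psi_iff ha hy b).1 hb).2.1 q hq

lemma AgreeAwayFrom.eq_of_loc_eq (h : AgreeAwayFrom p R R') {a b c : Submodule ℤ (Quat α β)}
    (ha : a ∈ leftIdeals R) (hb : b ∈ Psi R' a) (hc : c ∈ Psi R' a) (e : loc p b = loc p c) :
    b = c := by
  refine eq_of_forall_loc_eq hb.1.1 hc.1.1 fun q _ => ?_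
  rcases eq_or_ne q p with rfl | hq
  · exact e
  · rw [h.loc_eq_of_mem_Psi ha hb q hq, h.loc_eq_of_mem_Psi ha hc q hq]

/-- An ideal is determined by any one of its subideals of the same norm (it is `R b`). -/
lemma AgreeAwayFrom.eq_of_mem_Psi (h : AgreeAwayFrom p R R') {a a' b : Submodule ℤ (Quat α β)}
    (ha : a ∈ leftIdeals R) (ha' : a' ∈ leftIdeals R) (hb : b ∈ Psi R' a) (hb' : b ∈ Psi R' a') :
    a = a' := by
  refine eq_of_forall_loc_eq ha.1 ha'.1 fun q _ => ?_
  rcases eq_or_ne q p with rfl | hq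
  · obtain ⟨y, hy⟩ := ha.2 q
    obtain ⟨y', hy'⟩ := ha'.2 q
    obtain ⟨-, -, u, hu, hbu⟩ := (h.mem_Psi_iff ha hy b).1 hb
    obtain ⟨-, -, u', hu', hbu'⟩ := (h.mem_Psi_iff ha' hy' b).1 hb'
    rw [hbu, locRmul_eq_iff] at hbu'
    have h1 := (locUnits q R).mul_mem ((locUnits q R).mul_mem ((locUnits q R).inv_mem hu)
      (h.locUnits_le hbu')) hu'
    rw [hy, hy', locRmul_eq_iff]
    convert h1 using 1
    group
  · rw [← h.loc_eq_of_mem_Psi ha hb q hq, ← h.loc_eq_of_mem_Psi ha' hb' q hq]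

lemma rmul_mem_leftIdeals {a : Submodule ℤ (Quat α β)} (ha : a ∈ leftIdeals R)
    (x : (Quat α β)ˣ) : rmul a x ∈ leftIdeals R := by
  refine ⟨isLat_rmul ha.1 x, fun q _ => ?_⟩
  obtain ⟨y, hy⟩ := ha.2 q
  refine ⟨y * Units.map ((toLocal q : Quat α β →+* LQuat α β q) : Quat α β →* LQuat α β q) x, ?_⟩
  rw [loc_rmul, hy, locRmul_mul]
  rfl

lemma AgreeAwayFrom.rmul_mem_Psi (h : AgreeAwayFrom p R R') {a b : Submodule ℤ (Quat α β)}
    (ha : a ∈ leftIdeals R) (hb : b ∈ Psi R' a) (x : (Quat α β)ˣ) :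
    rmul b x ∈ Psi R' (rmul a x) := by
  obtain ⟨y, hy⟩ := ha.2 p
  obtain ⟨hbl, hq, u, hu, hbu⟩ := (h.mem_Psi_iff ha hy b).1 hb
  have hy' : loc p (rmul a x) = locRmul (locOrd p R) ((y * Units.map
      ((toLocal p : Quat α β →+* LQuat α β p) : Quat α β →* LQuat α β p) x :
        (LQuat α β p)ˣ) : LQuat α β p) := by
    rw [loc_rmul, hy, locRmul_mul]
    rfl
  refine (h.mem_Psi_iff (rmul_mem_leftIdeals ha x) hy' _).2 ⟨isLat_rmul hbl x, fun q _ hqp => ?_,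
    u, hu, ?_⟩
  · rw [loc_rmul, loc_rmul, hq q hqp]
  · rw [loc_rmul, hbu, locRmul_mul, ← mul_assoc u]
    rfl

lemma AgreeAwayFrom.exists_mem_leftIdeals (h : AgreeAwayFrom p R R') {b : Submodule ℤ (Quat α β)}
    (hb : b ∈ leftIdeals R') : ∃ a ∈ leftIdeals R, b ∈ Psi R' a := by
  obtain ⟨x, hx⟩ := hb.2 p
  obtain ⟨a, ha, hap, haq⟩ := exists_lat_of_loc p hb.1 h.order x
  have ha' : a ∈ leftIdeals R := by
    refine ⟨ha, fun q _ => ?_⟩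
    rcases eq_or_ne q p with rfl | hq
    · exact ⟨x, hap⟩
    · obtain ⟨z, hz⟩ := hb.2 q
      exact ⟨z, by rw [haq q hq, hz, h.loc_eq q hq]⟩
  refine ⟨a, ha', (h.mem_Psi_iff ha' hap b).2 ⟨hb.1, fun q _ hq => (haq q hq).symm, 1,
    one_mem _, ?_⟩⟩
  rw [one_mul]; exact hx

lemma rmul_inv_eq {a b : Submodule ℤ (Quat α β)} {x : (Quat α β)ˣ} (h : a = rmul b x) :
    b = rmul a ((x⁻¹ : (Quat α β)ˣ) : Quat α β) := by
  rw [h, rmul_rmul, Units.mul_inv, rmul_one]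

lemma AgreeAwayFrom.Cls_Psi_subset (h : AgreeAwayFrom p R R') {a a' : leftIdeals R}
    {x : (Quat α β)ˣ} (hx : (a : Submodule ℤ (Quat α β)) = rmul a' x) :
    Cls R' (Psi R' (a' : Submodule ℤ (Quat α β))) ⊆ Cls R' (Psi R' a) := by
  rintro _ ⟨b, hb, rfl⟩
  have hb' := h.rmul_mem_Psi a'.2 hb x
  rw [← hx] at hb'
  refine ⟨⟨_, hb'.1⟩, hb', Quotient.sound ?_⟩
  exact ⟨x, rfl⟩

/-- The class set of the smaller order fibres over that of the larger one. -/
lemma AgreeAwayFrom.classesDecompose (h : AgreeAwayFrom p R R') : ClassesDecompose R R' := by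
  refine ⟨Quotient.lift (fun a : leftIdeals R => Cls R' (Psi R' (a : Submodule ℤ (Quat α β)))) ?_,
    fun a => rfl, ?_, ?_⟩
  · rintro a a' ⟨x, hx⟩
    exact (h.Cls_Psi_subset (rmul_inv_eq hx)).antisymm (h.Cls_Psi_subset hx)
  · intro u v huv
    induction u using Quotient.ind with | _ a
    induction v using Quotient.ind with | _ a'
    refine Set.disjoint_left.2 ?_
    rintro _ ⟨b, hb, rfl⟩ ⟨b', hb', e⟩
    refine huv (Quotient.sound ?_)
    obtain ⟨x, hx⟩ := Quotient.exact e.symm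
    refine ⟨x, ?_⟩
    refine h.eq_of_mem_Psi (b := b) a.2 (rmul_mem_leftIdeals a'.2 x) hb ?_
    rw [hx]
    exact h.rmul_mem_Psi a'.2 hb' x
  · refine Set.eq_univ_of_forall fun c => ?_
    induction c using Quotient.ind with | _ b
    obtain ⟨a, ha, hba⟩ := h.exists_mem_leftIdeals b.2
    exact Set.mem_iUnion.2 ⟨cls ⟨a, ha⟩, b, hba, rfl⟩

end Subideals

/-! ### Torsors and the groups at `p` -/

section Torsors

/-- A group `Q` acts simply transitively on `X` as soon as `X` and `Q` are quotients of the same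
group `Γ` by the same relation; the action may be twisted by a second surjection `Γ → Q` with the
same kernel. -/
lemma exists_torsor {Γ Q X : Type*} [Group Γ] [Group Q] (π ρ : Γ →* Q)
    (hπ : Function.Surjective π) (hρ : Function.Surjective ρ) (hker : π.ker = ρ.ker)
    (m : Γ → X) (hm : Function.Surjective m) (hmπ : ∀ u u', m u = m u' ↔ π u = π u') :
    ∃ _ : Torsor Q X, ∀ g u u' : Γ, π u' = ρ g * π u → π g • m u = m u' := by
  let σ : Q ≃* Q := ((QuotientGroup.quotientKerEquivOfSurjective π hπ).symm.trans
    (QuotientGroup.quotientMulEquivOfEq hker)).trans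
    (QuotientGroup.quotientKerEquivOfSurjective ρ hρ)
  have hσ : ∀ g, σ (π g) = ρ g := by
    intro g
    have e : (QuotientGroup.quotientKerEquivOfSurjective π hπ).symm (π g) =
        (QuotientGroup.mk g : Γ ⧸ π.ker) := by
      rw [MulEquiv.symm_apply_eq]; rfl
    simp only [σ, MulEquiv.trans_apply, e]
    rfl
  have hs : ∀ x, m (Function.surjInv hm x) = x := Function.surjInv_eq hm
  let e : X ≃ Q := Equiv.ofBijective (fun x => π (Function.surjInv hm x)) (by
    constructor
    · intro x x' h
      rw [← hs x, ← hs x']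
      exact (hmπ _ _).2 h
    · intro q
      obtain ⟨u, rfl⟩ := hπ q
      exact ⟨m u, (hmπ _ _).1 (hs _)⟩)
  have he : ∀ u, e (m u) = π u := fun u => (hmπ _ _).1 (hs _)
  refine ⟨{ smul := fun q x => e.symm (σ q * e x)
            one_smul := fun x => ?_
            mul_smul := fun q q' x => ?_
            sdiv := fun x y => σ.symm (e x / e y)
            nonempty := ⟨m 1⟩
            sdiv_smul' := fun x y => ?_
            smul_sdiv' := fun q x => ?_ }, fun g u u' h => ?_⟩
  · change e.symm (σ (q * q') * e x) = e.symm (σ q * e (e.symm (σ q' * e x)))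
    simp [mul_assoc]
  · change e.symm (σ 1 * e x) = x
    simp
  · change e.symm (σ (σ.symm (e x / e y)) * e y) = x
    simp
  · change σ.symm (e (e.symm (σ q * e x)) / e x) = q
    simp
  · change e.symm (σ (π g) * e (m u)) = m u'
    rw [Equiv.symm_apply_eq, hσ, he, he, h]

variable {α β : ℚ} {p : ℕ} [Fact p.Prime] {O R : Subring (Quat α β)}

/-- If `R ⊇ pO` locally, then the preimage of the image of `R_p^×` in `ℋ` is `R_p^×` itself. -/
lemma toH_mem_subH (hR : IsOrder R) (hO : IsOrder O)
    (hp : ∀ z ∈ locOrd p O, p • z ∈ locOrd p R) (g : locUnits p O) :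
    toH g ∈ subH p O R ↔ (g : (LQuat α β p)ˣ) ∈ locUnits p R := by
  constructor
  · rintro ⟨h, hh, e⟩
    obtain ⟨u, y, hy, hu⟩ := QuotientGroup.eq.1 e
    have h1 : ((h⁻¹ * g : locUnits p O) : (LQuat α β p)ˣ) ∈ locUnits p R := by
      rw [mem_locUnits_iff hR]
      refine ⟨?_, ((mem_locUnits_iff hO _).1 (h⁻¹ * g : locUnits p O).2).2⟩
      rw [hu]
      refine scalar_mul_mem_locOrd _ (add_mem (one_mem_locOrd p R) ?_)
      rw [← nsmul_eq_mul]
      exact hp y hy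
    have h2 := (locUnits p R).mul_mem hh h1
    simpa using h2
  · intro h
    exact ⟨g, h, rfl⟩

end Torsors

/-! ### The completion of a maximal order at `p` -/

section MaximalOrder

variable {α β : ℚ} {p : ℕ} [hpf : Fact p.Prime]

lemma nm_nsmul {K : Type*} [Field K] {a b : K} (n : ℕ) (z : ℍ[K, a, b]) :
    nm (n • z) = (n : K) ^ 2 * nm z := by
  rw [nsmul_eq_mul, nm_mul, nm_natCast]

lemma tr_nsmul {K : Type*} [Field K] {a b : K} (n : ℕ) (z : ℍ[K, a, b]) :
    tr (n • z) = (n : K) * tr z := by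
  rw [tr_eq, tr_eq, QuaternionAlgebra.re_smul, nsmul_eq_mul]; ring

lemma norm_nm_p_smul (z : LQuat α β p) : ‖nm (p • z)‖ = (p : ℝ)⁻¹ ^ 2 * ‖nm z‖ := by
  rw [nm_nsmul, norm_mul, norm_pow, Padic.norm_p]

/-- The valuation ring as a `ℤ_p`-lattice. -/
def valLat (hD : IsRamifiedOver ℚ_[p] (α : ℚ_[p]) (β : ℚ_[p])) :
    Submodule ℤ_[p] (LQuat α β p) where
  carrier := {x | ‖nm x‖ ≤ 1}
  add_mem' := fun {x y} hx hy => (hD.norm_nm_add_le x y).trans (max_le hx hy)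
  zero_mem' := by simp
  smul_mem' := fun c x hx => by
    change ‖nm (c • x)‖ ≤ 1
    rw [nm_padicInt_smul, norm_mul, norm_pow]
    exact mul_le_one₀ (pow_le_one₀ (norm_nonneg _) c.2) (norm_nonneg _) hx

lemma pow_nsmul_mem_of_le {L : Submodule ℤ (Quat α β)} {z : LQuat α β p} {k n : ℕ} (hkn : k ≤ n)
    (h : p ^ k • z ∈ loc p L) : p ^ n • z ∈ loc p L := by
  rw [← Nat.sub_add_cancel hkn, pow_add, mul_smul]
  exact Submodule.smul_of_tower_mem _ _ h

/-- The functional `z ↦ tr(z f)` is bounded on the valuation ring, because a multiple of `f` lies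
in that ring and traces are integral on it. -/
lemma exists_pow_tr_smul_mem (hD : IsRamifiedOver ℚ_[p] (α : ℚ_[p]) (β : ℚ_[p]))
    {L : Submodule ℤ (Quat α β)} (hL : IsLat L) (f g : LQuat α β p) :
    ∃ k : ℕ, ∀ z : LQuat α β p, ‖nm z‖ ≤ 1 →
      p ^ k • (algebraMap ℚ_[p] _ (tr (z * f)) * g) ∈ loc p L := by
  obtain ⟨l, hl⟩ := exists_pow_nsmul_mem_loc hL g
  have hp1 : (1 : ℝ) < p := by exact_mod_cast hpf.out.one_lt
  obtain ⟨m, hm⟩ := pow_unbounded_of_one_lt ‖nm f‖ hp1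
  refine ⟨m + l, fun z hz => ?_⟩
  have hf : ‖nm (p ^ m • f)‖ ≤ 1 := by
    rw [nm_nsmul, norm_mul, norm_pow, Nat.cast_pow, norm_pow, Padic.norm_p, ← pow_mul, inv_pow,
      inv_mul_le_one₀ (by positivity)]
    exact hm.le.trans (pow_le_pow_right₀ hp1.le (by omega))
  have ht : ‖tr (z * (p ^ m • f))‖ ≤ 1 :=
    hD.norm_tr_le (by rw [nm_mul, norm_mul]; exact mul_le_one₀ hz (norm_nonneg _) hf)
  rw [mul_smul_comm, tr_nsmul] at ht
  have e : p ^ (m + l) • (algebraMap ℚ_[p] _ (tr (z * f)) * g) =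
      algebraMap ℚ_[p] (LQuat α β p) (((p ^ m : ℕ) : ℚ_[p]) * tr (z * f)) * (p ^ l • g) := by
    rw [map_mul, map_natCast, pow_add, nsmul_eq_mul, nsmul_eq_mul, Nat.cast_mul, mul_assoc,
      mul_assoc, (Nat.cast_commute (p ^ l) (algebraMap ℚ_[p] (LQuat α β p) (tr (z * f)))).left_comm]
  obtain ⟨c, hc⟩ : ∃ c : ℤ_[p], (c : ℚ_[p]) = ((p ^ m : ℕ) : ℚ_[p]) * tr (z * f) :=
    ⟨⟨_, ht⟩, rfl⟩
  rw [e, ← hc, ← padicInt_smul_eq]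
  exact Submodule.smul_mem _ c hl

/-- The valuation ring is bounded, because the trace form is nondegenerate and integral on it. -/
lemma exists_pow_smul_mem_of_norm_le_one (hD : IsRamifiedOver ℚ_[p] (α : ℚ_[p]) (β : ℚ_[p]))
    {L : Submodule ℤ (Quat α β)} (hL : IsLat L) :
    ∃ k : ℕ, ∀ z : LQuat α β p, ‖nm z‖ ≤ 1 → p ^ k • z ∈ loc p L := by
  obtain ⟨ha, hb⟩ := hD.ne_zero
  -- Expand `z` as the sum of `tr(z f) g`, with `f` in `{1, i, j, k}` and `g` in the dual basis.
  obtain ⟨k₀, h₀⟩ := exists_pow_tr_smul_mem hD hL ⟨1, 0, 0, 0⟩ ⟨2⁻¹, 0, 0, 0⟩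
  obtain ⟨k₁, h₁⟩ := exists_pow_tr_smul_mem hD hL ⟨0, 1, 0, 0⟩ ⟨0, (2 * (α : ℚ_[p]))⁻¹, 0, 0⟩
  obtain ⟨k₂, h₂⟩ := exists_pow_tr_smul_mem hD hL ⟨0, 0, 1, 0⟩ ⟨0, 0, (2 * (β : ℚ_[p]))⁻¹, 0⟩
  obtain ⟨k₃, h₃⟩ := exists_pow_tr_smul_mem hD hL ⟨0, 0, 0, 1⟩
    ⟨0, 0, 0, -(2 * ((α : ℚ_[p]) * β))⁻¹⟩
  refine ⟨k₀ + k₁ + k₂ + k₃, fun z hz => ?_⟩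
  have h := add_mem (add_mem (add_mem
    (pow_nsmul_mem_of_le (n := k₀ + k₁ + k₂ + k₃) (by omega) (h₀ z hz))
    (pow_nsmul_mem_of_le (n := k₀ + k₁ + k₂ + k₃) (by omega) (h₁ z hz)))
    (pow_nsmul_mem_of_le (n := k₀ + k₁ + k₂ + k₃) (by omega) (h₂ z hz)))
    (pow_nsmul_mem_of_le (n := k₀ + k₁ + k₂ + k₃) (by omega) (h₃ z hz))
  rw [← smul_add, ← smul_add, ← smul_add] at h
  convert h using 2
  ext <;> simp [tr_eq, QuaternionAlgebra.algebraMap_eq] <;> field_simp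

/-- The completion of a maximal order at `p` is the full valuation ring. -/
lemma IsMaximalOrder.mem_locOrd {O : Subring (Quat α β)} (hO : IsMaximalOrder O)
    (hD : IsRamifiedOver ℚ_[p] (α : ℚ_[p]) (β : ℚ_[p])) {z : LQuat α β p} :
    z ∈ locOrd p O ↔ ‖nm z‖ ≤ 1 := by
  refine ⟨norm_nm_le_one hO.1, fun hz => ?_⟩
  obtain ⟨k, hk⟩ := exists_pow_smul_mem_of_norm_le_one hD hO.1
  obtain ⟨hlat, hloc, -⟩ := glue_spec (M := valLat hD) (k := k) hO.1
    (fun z hz => Submodule.smul_of_tower_mem _ _ (norm_nm_le_one hO.1 hz)) hk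
  -- The lattice `O[1/p] ∩ {|N| ≤ 1}` is an order containing `O`.
  let O₁ : Subring (Quat α β) :=
    { glue p (asLat O) (valLat hD) with
      neg_mem' := fun {x} hx => neg_mem (S := Submodule ℤ (Quat α β)) hx
      one_mem' := ⟨by rw [map_one]; exact (by simp : ‖nm (1 : LQuat α β p)‖ ≤ 1), 0, by
        rw [pow_zero, one_smul]; exact O.one_mem⟩
      mul_mem' := by
        rintro x y ⟨hx, l, hl⟩ ⟨hy, m, hm⟩
        refine ⟨?_, l + m, ?_⟩
        · rw [map_mul]; exact (valRing hD).mul_mem hx hy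
        · rw [pow_add, mul_smul, ← mul_smul_comm, ← smul_mul_assoc]
          exact O.mul_mem hl hm }
  have e : asLat O₁ = glue p (asLat O) (valLat hD) := rfl
  have hle : O ≤ O₁ := fun x hx =>
    ⟨norm_nm_le_one hO.1 (toLocal_mem_loc (L := asLat O) hx), 0, by
      rw [pow_zero, one_smul]; exact hx⟩
  have h1 : O₁ ≤ O := hO.2 (show IsOrder O₁ from hlat) hle
  have h2 : loc p (asLat O₁) ≤ loc p (asLat O) := loc_mono h1
  rw [e, hloc] at h2
  exact h2 hz

lemma loc_nsmul_mem {q n : ℕ} [Fact q.Prime] {L L' : Submodule ℤ (Quat α β)}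
    (h : ∀ x ∈ L, n • x ∈ L') {z : LQuat α β q} (hz : z ∈ loc q L) : n • z ∈ loc q L' := by
  induction hz using Submodule.span_induction with
  | mem z h' =>
    obtain ⟨x, hx, rfl⟩ := h'
    rw [← map_nsmul (toLocal q)]
    exact toLocal_mem_loc (h x hx)
  | zero => simp
  | add x y _ _ hx hy => rw [smul_add]; exact add_mem hx hy
  | smul c x _ hx => rw [smul_comm]; exact Submodule.smul_mem _ _ hx

lemma norm_nm_p_smul_lt (z : LQuat α β p) (hz : ‖nm z‖ ≤ 1) : ‖nm (p • z)‖ < 1 := by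
  have hp1 : (p : ℝ)⁻¹ < 1 := inv_lt_one_of_one_lt₀ (by exact_mod_cast hpf.out.one_lt)
  have hp0 : (0 : ℝ) ≤ (p : ℝ)⁻¹ := by positivity
  rw [norm_nm_p_smul]
  exact (mul_le_of_le_one_right (by positivity) hz).trans_lt (pow_lt_one₀ hp0 hp1 two_ne_zero)

lemma IsMaximalOrder.finite_residue {O : Subring (Quat α β)} (hO : IsMaximalOrder O)
    (hD : IsRamifiedOver ℚ_[p] (α : ℚ_[p]) (β : ℚ_[p])) :
    Finite (valRing hD ⧸ valIdeal hD) := by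
  let φ : asLat O →ₗ[ℤ] (valRing hD ⧸ valIdeal hD) :=
    AddMonoidHom.toIntLinearMap
      { toFun := fun x => Ideal.Quotient.mk (valIdeal hD)
          ⟨toLocal p (x : Quat α β), (hO.mem_locOrd hD).1 (toLocal_mem_loc x.2)⟩
        map_zero' := by
          rw [Ideal.Quotient.eq_zero_iff_mem, mem_valIdeal]; simp
        map_add' := fun x y => by
          rw [← map_add]
          congr 1 }
  have hφ : Function.Surjective φ := by
    intro z
    obtain ⟨⟨z, hz⟩, rfl⟩ := Ideal.Quotient.mk_surjective z
    obtain ⟨x, hx, w, hw, e⟩ := exists_approx 1 ((hO.mem_locOrd hD).2 hz)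
    refine ⟨⟨x, hx⟩, ?_⟩
    refine (Ideal.Quotient.mk_eq_mk_iff_sub_mem _ _).2 ?_
    rw [mem_valIdeal]
    change ‖nm (toLocal p x - z)‖ < 1
    rw [e, sub_add_cancel_left, nm_neg, pow_one]
    exact norm_nm_p_smul_lt w ((hO.mem_locOrd hD).1 hw)
  have : Module.Finite ℤ (asLat O) := Module.Finite.iff_fg.2 hO.1.fg
  have hfin : Module.Finite ℤ (valRing hD ⧸ valIdeal hD) := Module.Finite.of_surjective φ hφ
  have : AddGroup.FG (valRing hD ⧸ valIdeal hD) := Module.Finite.iff_addGroup_fg.1 hfin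
  refine AddCommGroup.finite_of_fg_isAddTorsion _ fun z => ?_
  obtain ⟨⟨z, hz⟩, rfl⟩ := Ideal.Quotient.mk_surjective z
  refine isOfFinAddOrder_iff_nsmul_eq_zero.2 ⟨p, hpf.out.pos, ?_⟩
  rw [← map_nsmul, Ideal.Quotient.eq_zero_iff_mem, mem_valIdeal]
  exact norm_nm_p_smul_lt z hz

end MaximalOrder

/-! ### Multiplication in the maximal ideal -/

section MaximalIdeal

variable {α β : ℚ} {p : ℕ} [hpf : Fact p.Prime]

lemma norm_le_inv_of_lt_one {x : ℚ_[p]} (h : ‖x‖ < 1) : ‖x‖ ≤ (p : ℝ)⁻¹ := by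
  have := (Padic.norm_le_pow_iff_norm_lt_pow_add_one x (-1)).2 (by simpa using h)
  simpa using this

/-- The square of the maximal ideal is contained in the multiples of `p`. -/
lemma exists_p_smul_eq_mul {y z : LQuat α β p} (hy : ‖nm y‖ < 1) (hz : ‖nm z‖ < 1) :
    ∃ w : LQuat α β p, ‖nm w‖ ≤ 1 ∧ y * z = p • w := by
  have hp0 : (p : ℚ_[p]) ≠ 0 := Nat.cast_ne_zero.2 hpf.out.ne_zero
  have hp0' : (p : ℝ) ≠ 0 := Nat.cast_ne_zero.2 hpf.out.ne_zero
  have e : y * z = p • (algebraMap ℚ_[p] _ (p : ℚ_[p])⁻¹ * (y * z)) := by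
    rw [nsmul_eq_mul, ← map_natCast (algebraMap ℚ_[p] (LQuat α β p)), ← mul_assoc, ← map_mul,
      mul_inv_cancel₀ hp0, map_one, one_mul]
  refine ⟨_, ?_, e⟩
  rw [nm_mul, nm_algebraMap, nm_mul, norm_mul, norm_mul, norm_pow, norm_inv, Padic.norm_p, inv_inv]
  have h1 := mul_le_mul (norm_le_inv_of_lt_one hy) (norm_le_inv_of_lt_one hz) (norm_nonneg _)
    (by positivity)
  calc (p : ℝ) ^ 2 * (‖nm y‖ * ‖nm z‖) ≤ (p : ℝ) ^ 2 * ((p : ℝ)⁻¹ * (p : ℝ)⁻¹) := by gcongr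
    _ = 1 := by field_simp

lemma norm_two_eq_one (hp : 2 < p) : ‖(2 : ℚ_[p])‖ = 1 := by
  have := (Padic.norm_natCast_eq_one_iff (p := p) (n := 2)).2
    ((Nat.coprime_primes hpf.out Nat.prime_two).2 hp.ne')
  simpa using this

lemma IsRamifiedOver.norm_tr_lt (hD : IsRamifiedOver ℚ_[p] (α : ℚ_[p]) (β : ℚ_[p]))
    {y : LQuat α β p} (hy : ‖nm y‖ < 1) : ‖tr y‖ < 1 := by
  have h := hD.norm_nm_add_le y (star y)
  have e : y + star y = algebraMap ℚ_[p] _ (tr y) := by rw [star_eq]; abel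
  rw [e, nm_star, max_self, nm_algebraMap, norm_pow] at h
  exact (sq_lt_one_iff₀ (norm_nonneg _)).1 (h.trans_lt hy)

end MaximalIdeal

/-! ### The orders of index `p` and of level `p²` -/

section Tower

variable {α β : ℚ} {p : ℕ} [hpf : Fact p.Prime] {O Ot O' : Subring (Quat α β)}

/-- A tower of orders in an algebra ramified at `p > 2`: a maximal order `O`, the order `Ot` of its
elements of discriminant divisible by `p`, and an order `O'` of index `p` in `Ot`. -/
structure IsLevelTower (p : ℕ) [Fact p.Prime] (O Ot O' : Subring (Quat α β)) : Prop where
  two_lt : 2 < p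
  ramified : IsRamifiedOver ℚ_[p] (α : ℚ_[p]) (β : ℚ_[p])
  maximal : IsMaximalOrder O
  middle : (Ot : Set (Quat α β)) = {x | x ∈ O ∧ ∃ k : ℤ, discr x = (p : ℚ) * k}
  index : IsOrderOfIndex p Ot O'

namespace IsLevelTower

lemma mem_locOrd_O (h : IsLevelTower p O Ot O') {z : LQuat α β p} : z ∈ locOrd p O ↔ ‖nm z‖ ≤ 1 :=
  h.maximal.mem_locOrd h.ramified

lemma mem_Ot (h : IsLevelTower p O Ot O') {x : Quat α β} :
    x ∈ Ot ↔ x ∈ O ∧ ∃ k : ℤ, discr x = (p : ℚ) * k := by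
  rw [← SetLike.mem_coe, h.middle]; rfl

lemma Ot_le (h : IsLevelTower p O Ot O') : Ot ≤ O := fun _ hx => (h.mem_Ot.1 hx).1

/-- Membership in `Ot` is the condition `|discr x|_p < 1`, as discriminants are integral. -/
lemma mem_Ot_iff (h : IsLevelTower p O Ot O') {x : Quat α β} :
    x ∈ Ot ↔ x ∈ O ∧ ‖((discr x : ℚ) : ℚ_[p])‖ < 1 := by
  rw [h.mem_Ot]
  refine and_congr_right fun hx => ⟨?_, fun hlt => ?_⟩
  · rintro ⟨k, hk⟩
    rw [hk, Rat.cast_mul, norm_mul, Rat.cast_natCast, Rat.cast_intCast]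
    exact (mul_le_of_le_one_right (norm_nonneg _) (Padic.norm_int_le_one k)).trans_lt
      Padic.norm_p_lt_one
  · obtain ⟨n, hn⟩ := exists_int_of_norm_le_one (r := discr x) fun q _ => by
      have hx' := toLocal_mem_loc (q := q) (L := asLat O) hx
      have ht := norm_tr_le_one h.maximal.1 hx'
      have hn := norm_nm_le_one h.maximal.1 hx'
      rw [tr_toLocal] at ht
      rw [nm_toLocal] at hn
      rw [discr, Rat.cast_sub, sub_eq_add_neg]
      refine (Padic.nonarchimedean _ _).trans (max_le ?_ ?_)
      · rw [Rat.cast_pow, norm_pow]; exact pow_le_one₀ (norm_nonneg _) ht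
      · rw [norm_neg, Rat.cast_mul, norm_mul]
        exact mul_le_one₀ (by exact_mod_cast Padic.norm_int_le_one (p := q) 4) (norm_nonneg _) hn
    rw [← hn, Rat.cast_intCast, Padic.norm_intCast_lt_one_iff] at hlt
    obtain ⟨k, hk⟩ := hlt
    exact ⟨k, by rw [← hn, hk]; push_cast; ring⟩

lemma smul_mem_Ot (h : IsLevelTower p O Ot O') {x : Quat α β} (hx : x ∈ O) : p • x ∈ Ot := by
  rw [h.mem_Ot_iff]
  have hx' := toLocal_mem_loc (q := p) (L := asLat O) hx
  have ht := norm_tr_le_one h.maximal.1 hx'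
  have hn := norm_nm_le_one h.maximal.1 hx'
  refine ⟨O.nsmul_mem hx p, ?_⟩
  have e : ((discr (p • x) : ℚ) : ℚ_[p]) = -nm (2 * toLocal p (p • x) -
      algebraMap ℚ_[p] _ (tr (toLocal p (p • x)))) := by
    rw [nm_two_mul_sub, tr_toLocal, nm_toLocal, discr]; push_cast; ring
  have e2 : 2 * toLocal p (p • x) - algebraMap ℚ_[p] _ (tr (toLocal p (p • x))) =
      p • (2 * toLocal p x - algebraMap ℚ_[p] _ (tr (toLocal p x))) := by
    rw [map_nsmul, tr_nsmul, smul_sub, map_mul, map_natCast, mul_smul_comm, nsmul_eq_mul p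
      (algebraMap ℚ_[p] (LQuat α β p) _)]
  rw [e, norm_neg, e2]
  refine norm_nm_p_smul_lt _ (norm_nm_le_one h.maximal.1 (sub_mem ?_ (algebraMap_mem_locOrd ht)))
  rw [two_mul]
  exact add_mem hx' hx'

lemma order_Ot (h : IsLevelTower p O Ot O') : IsOrder Ot :=
  isLat_of_nsmul (n := p) (m := 1) one_ne_zero h.maximal.1 hpf.out.ne_zero
    (fun _ hx => h.smul_mem_Ot hx) (fun x hx => by rw [one_smul]; exact h.Ot_le hx)

lemma order_O' (h : IsLevelTower p O Ot O') : IsOrder O' := h.index.1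

lemma O'_le (h : IsLevelTower p O Ot O') : O' ≤ Ot := h.index.2.1

lemma smul_mem_O' (h : IsLevelTower p O Ot O') {x : Quat α β} (hx : x ∈ Ot) : p • x ∈ O' := by
  have h1 := AddSubgroup.nsmul_index_mem (O'.toAddSubgroup.addSubgroupOf Ot.toAddSubgroup) ⟨x, hx⟩
  have h2 : (O'.toAddSubgroup.addSubgroupOf Ot.toAddSubgroup).index = p := h.index.2.2
  rw [h2] at h1
  exact h1

lemma loc_eq_of_ne {R R' : Subring (Quat α β)} (hle : R' ≤ R) (hp : ∀ x ∈ R, p • x ∈ R')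
    (q : ℕ) [hq : Fact q.Prime] (hqp : q ≠ p) : locOrd q R' = locOrd q R :=
  le_antisymm (loc_mono hle)
    (loc_le_of_nsmul ((Nat.coprime_primes hq.out hpf.out).2 hqp) hp)

lemma agree₁ (h : IsLevelTower p O Ot O') : AgreeAwayFrom p O Ot :=
  ⟨h.maximal.1, h.order_Ot, h.Ot_le, fun q _ hq => loc_eq_of_ne h.Ot_le
    (fun _ hx => h.smul_mem_Ot hx) q hq⟩

lemma agree₂ (h : IsLevelTower p O Ot O') : AgreeAwayFrom p Ot O' :=
  ⟨h.order_Ot, h.order_O', h.O'_le, fun q _ hq => loc_eq_of_ne h.O'_le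
    (fun _ hx => h.smul_mem_O' hx) q hq⟩

lemma norm_nm_sub_lt (h : IsLevelTower p O Ot O') {x y : LQuat α β p} (hx : ‖nm x‖ < 1)
    (hy : ‖nm y‖ < 1) :
    ‖nm (x - y)‖ < 1 :=
  (h.ramified.norm_nm_sub_le x y).trans_lt (max_lt hx hy)

lemma norm_nm_add_lt (h : IsLevelTower p O Ot O') {x y : LQuat α β p} (hx : ‖nm x‖ < 1)
    (hy : ‖nm y‖ < 1) :
    ‖nm (x + y)‖ < 1 :=
  (h.ramified.norm_nm_add_le x y).trans_lt (max_lt hx hy)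

/-- For an element of `ℤ_p + P` (`P` the maximal ideal), half the trace is a scalar part. -/
lemma norm_nm_sub_half_tr_lt (h : IsLevelTower p O Ot O') {c : ℚ_[p]} {z : LQuat α β p}
    (hz : ‖nm (z - algebraMap ℚ_[p] _ c)‖ < 1) :
    ‖nm (z - algebraMap ℚ_[p] _ (tr z / 2))‖ < 1 := by
  set y := z - algebraMap ℚ_[p] _ c with hy
  have e : z - algebraMap ℚ_[p] _ (tr z / 2) = y - algebraMap ℚ_[p] _ (tr y / 2) := by
    have : z = y + algebraMap ℚ_[p] _ c := by rw [hy]; abel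
    rw [this, tr_add, tr_algebraMap, show (tr y + 2 * c) / 2 = tr y / 2 + c by ring, map_add]
    abel
  rw [e]
  refine h.norm_nm_sub_lt hz ?_
  rw [nm_algebraMap, norm_pow, norm_div, norm_two_eq_one h.two_lt, div_one]
  exact pow_lt_one₀ (norm_nonneg _) (h.ramified.norm_tr_lt hz) two_ne_zero

/-- `Ot_p = ℤ_p + P`, where `P` is the maximal ideal of `O_p`. -/
lemma mem_locOrd_Ot (h : IsLevelTower p O Ot O') {z : LQuat α β p} :
    z ∈ locOrd p Ot ↔ ‖nm z‖ ≤ 1 ∧ ‖nm (z - algebraMap ℚ_[p] _ (tr z / 2))‖ < 1 := by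
  have key : ∀ x : Quat α β, ((discr x : ℚ) : ℚ_[p]) = -nm (2 * toLocal p x -
      algebraMap ℚ_[p] _ (tr (toLocal p x))) := fun x => by
    rw [nm_two_mul_sub, tr_toLocal, nm_toLocal, discr]; push_cast; ring
  have key2 : ∀ x : Quat α β, ‖((discr x : ℚ) : ℚ_[p])‖ =
      ‖nm (toLocal p x - algebraMap ℚ_[p] _ (tr (toLocal p x) / 2))‖ := fun x => by
    have e : 2 * toLocal p x - algebraMap ℚ_[p] _ (tr (toLocal p x)) =
        2 • (toLocal p x - algebraMap ℚ_[p] _ (tr (toLocal p x) / 2)) := by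
      rw [smul_sub, two_mul, two_smul, two_smul,
        ← map_add (algebraMap ℚ_[p] (LQuat α β p)), add_halves]
    rw [key, e, norm_neg, nm_nsmul, norm_mul, norm_pow]
    simp only [Nat.cast_ofNat, norm_two_eq_one h.two_lt]
    ring
  constructor
  · intro hz
    refine ⟨norm_nm_le_one h.order_Ot hz, ?_⟩
    obtain ⟨x, hx, w, hw, e⟩ := exists_approx 1 hz
    refine h.norm_nm_sub_half_tr_lt (c := tr (toLocal p x) / 2) ?_
    rw [e, add_sub_right_comm, pow_one]
    refine h.norm_nm_add_lt ?_ (norm_nm_p_smul_lt w (norm_nm_le_one h.order_Ot hw))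
    rw [← key2]
    exact (h.mem_Ot_iff.1 hx).2
  · rintro ⟨hz, hy⟩
    obtain ⟨x, hx, w, hw, e⟩ := exists_approx 1 (h.mem_locOrd_O.2 hz)
    rw [pow_one] at e
    rw [e]
    have hw' := norm_nm_p_smul_lt w (h.mem_locOrd_O.1 hw)
    refine add_mem (toLocal_mem_loc (L := asLat Ot) (h.mem_Ot_iff.2 ⟨hx, ?_⟩))
      (loc_nsmul_mem (L := asLat O) (fun _ hx => h.smul_mem_Ot hx) hw)
    rw [key2]
    refine h.norm_nm_sub_half_tr_lt (c := tr z / 2) ?_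
    rw [eq_sub_of_add_eq e.symm, sub_right_comm]
    exact h.norm_nm_sub_lt hy hw'

lemma mem_locOrd_Ot_of_sub (h : IsLevelTower p O Ot O') {c : ℚ_[p]} (hc : ‖c‖ ≤ 1) {z : LQuat α β p}
    (hz : ‖nm (z - algebraMap ℚ_[p] _ c)‖ < 1) : z ∈ locOrd p Ot := by
  refine h.mem_locOrd_Ot.2 ⟨?_, h.norm_nm_sub_half_tr_lt hz⟩
  have e : z = (z - algebraMap ℚ_[p] _ c) + algebraMap ℚ_[p] _ c := by abel
  rw [e]
  refine (h.ramified.norm_nm_add_le _ _).trans (max_le hz.le ?_)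
  rw [nm_algebraMap, norm_pow]
  exact pow_le_one₀ (norm_nonneg _) hc

lemma mem_locOrd_Ot_of_lt (h : IsLevelTower p O Ot O') {z : LQuat α β p} (hz : ‖nm z‖ < 1) :
    z ∈ locOrd p Ot :=
  h.mem_locOrd_Ot_of_sub (c := 0) (by simp) (by simpa using hz)

/-- `p O_p ⊆ O'_p`. The group `O' + pO` lies between `O'` and `Ot`, so equals one of them; if it
were `Ot`, then writing `p o = π w` with `π, w` in the maximal ideal, and `π, w` as elements of
`O'_p + p O_p`, gives `p o ∈ O'_p + p Ot_p = O'_p` all the same. -/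
lemma smul_mem_locOrd_O' (h : IsLevelTower p O Ot O') {z : LQuat α β p} (hz : ‖nm z‖ ≤ 1) :
    p • z ∈ locOrd p O' := by
  have hpT : ∀ w ∈ locOrd p Ot, p • w ∈ locOrd p O' := fun w hw =>
    loc_nsmul_mem (L := asLat Ot) (fun _ hx => h.smul_mem_O' hx) hw
  let Y : AddSubgroup (Quat α β) := O.toAddSubgroup.map (nsmulAddMonoidHom p)
  let X : AddSubgroup (Quat α β) := O'.toAddSubgroup ⊔ Y
  have hYt : Y ≤ Ot.toAddSubgroup := by
    rintro _ ⟨x, hx, rfl⟩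
    exact h.smul_mem_Ot hx
  have hXt : X ≤ Ot.toAddSubgroup := sup_le h.O'_le hYt
  have hidx := AddSubgroup.relIndex_mul_relIndex _ _ _ (le_sup_left : O'.toAddSubgroup ≤ X) hXt
  rw [h.index.2.2] at hidx
  have hcases : O'.toAddSubgroup.relIndex X = 1 ∨ X.relIndex Ot.toAddSubgroup = 1 :=
    (Nat.prime_mul_iff.1 (hidx.symm ▸ hpf.out)).elim (fun h => Or.inr h.2) (fun h => Or.inl h.2)
  rcases hcases with h1 | h1
  · rw [AddSubgroup.relIndex_eq_one] at h1
    refine loc_nsmul_mem (L := asLat O) (fun x hx => ?_) (h.mem_locOrd_O.2 hz)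
    exact h1 ((le_sup_right : Y ≤ X) ⟨x, hx, rfl⟩)
  · rw [AddSubgroup.relIndex_eq_one] at h1
    have split : ∀ t ∈ locOrd p Ot, ∃ r ∈ locOrd p O', ∃ s : LQuat α β p,
        ‖nm s‖ ≤ 1 ∧ t = r + p • s := by
      intro t ht
      obtain ⟨x, hx, w, hw, rfl⟩ := exists_approx 1 ht
      obtain ⟨r, hr, _, ⟨s, hs, rfl⟩, hrs⟩ := AddSubgroup.mem_sup.1 (h1 hx)
      refine ⟨toLocal p r, toLocal_mem_loc (L := asLat O') hr, toLocal p s + w, ?_, ?_⟩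
      · exact h.mem_locOrd_O.1 (add_mem (toLocal_mem_loc (L := asLat O) hs) (loc_mono h.Ot_le hw))
      · rw [← hrs, map_add, smul_add, pow_one, nsmulAddMonoidHom_apply, map_nsmul]
        abel
    have := h.maximal.finite_residue h.ramified
    obtain ⟨π, hπ⟩ := h.ramified.exists_uniformizer h.two_lt
    have hp1 : (p : ℝ)⁻¹ < 1 := inv_lt_one_of_one_lt₀ (by exact_mod_cast hpf.out.one_lt)
    have hp0 : (0 : ℝ) < (p : ℝ)⁻¹ := inv_pos.2 (by exact_mod_cast hpf.out.pos)
    obtain ⟨u, rfl⟩ := exists_unit_of_nm_ne_zero (x := π) (by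
      rw [← norm_pos_iff, hπ]; exact hp0)
    set w : LQuat α β p := ((u⁻¹ : (LQuat α β p)ˣ) : LQuat α β p) * (p • z) with hw
    have hw1 : ‖nm w‖ < 1 := by
      rw [hw, nm_mul, nm_unit_inv, norm_mul, norm_inv, hπ, norm_nm_p_smul, pow_two, ← mul_assoc,
        ← mul_assoc, inv_mul_cancel₀ hp0.ne', one_mul]
      exact (mul_le_of_le_one_right hp0.le hz).trans_lt hp1
    have huw : p • z = (u : LQuat α β p) * w := by rw [hw, ← mul_assoc, Units.mul_inv, one_mul]
    obtain ⟨r, hr, a, ha, e₁⟩ := split _ (h.mem_locOrd_Ot_of_lt (hπ.trans_lt hp1))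
    obtain ⟨s, hs, b, hb, e₂⟩ := split _ (h.mem_locOrd_Ot_of_lt hw1)
    have hrP : ‖nm r‖ < 1 := by
      rw [eq_sub_of_add_eq e₁.symm]
      exact h.norm_nm_sub_lt (hπ.trans_lt hp1) (norm_nm_p_smul_lt a ha)
    have hsP : ‖nm s‖ < 1 := by
      rw [eq_sub_of_add_eq e₂.symm]
      exact h.norm_nm_sub_lt hw1 (norm_nm_p_smul_lt b hb)
    have e : p • z = r * s + p • (a * s + r * b + p • (a * b)) := by
      rw [huw, e₁, e₂]
      simp only [mul_add, add_mul, smul_add, mul_smul_comm, smul_mul_assoc]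
      abel
    rw [e]
    refine add_mem (mul_mem_locOrd hr hs) (hpT _ (h.mem_locOrd_Ot_of_lt ?_))
    refine h.norm_nm_add_lt (h.norm_nm_add_lt ?_ ?_) (norm_nm_p_smul_lt _ ?_)
    · rw [nm_mul, norm_mul]; exact mul_lt_one_of_nonneg_of_lt_one_right ha (norm_nonneg _) hsP
    · rw [nm_mul, norm_mul]; exact mul_lt_one_of_nonneg_of_lt_one_left (norm_nonneg _) hrP hb
    · rw [nm_mul, norm_mul]; exact mul_le_one₀ ha (norm_nonneg _) hb

lemma mul_mem_locOrd_O' (h : IsLevelTower p O Ot O') {y z : LQuat α β p} (hy : ‖nm y‖ < 1)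
    (hz : ‖nm z‖ < 1) :
    y * z ∈ locOrd p O' := by
  obtain ⟨w, hw, e⟩ := exists_p_smul_eq_mul hy hz
  rw [e]; exact h.smul_mem_locOrd_O' hw

lemma mem_locUnits_O (h : IsLevelTower p O Ot O') (u : (LQuat α β p)ˣ) :
    u ∈ locUnits p O ↔ ‖nm (u : LQuat α β p)‖ = 1 := by
  rw [mem_locUnits_iff h.maximal.1, h.mem_locOrd_O]
  exact ⟨fun h => h.2, fun h => ⟨h.le, h⟩⟩

lemma conj_mem_locUnits_O (h : IsLevelTower p O Ot O') (y : (LQuat α β p)ˣ) {u : (LQuat α β p)ˣ}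
    (hu : u ∈ locUnits p O) :
    y * u * y⁻¹ ∈ locUnits p O := by
  rw [h.mem_locUnits_O] at *
  rw [Units.val_mul, Units.val_mul, nm_conj, hu]

/-- `Ot_p` is stable under conjugation by the whole division algebra. -/
lemma conj_mem_locOrd_Ot (h : IsLevelTower p O Ot O') (y : (LQuat α β p)ˣ) {z : LQuat α β p}
    (hz : z ∈ locOrd p Ot) :
    (y : LQuat α β p) * z * ((y⁻¹ : (LQuat α β p)ˣ) : LQuat α β p) ∈ locOrd p Ot := by
  rw [h.mem_locOrd_Ot] at *
  refine ⟨by rw [nm_conj]; exact hz.1, ?_⟩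
  rw [tr_conj]
  have e : (y : LQuat α β p) * z * ((y⁻¹ : (LQuat α β p)ˣ) : LQuat α β p) -
      algebraMap ℚ_[p] _ (tr z / 2) = (y : LQuat α β p) * (z - algebraMap ℚ_[p] _ (tr z / 2)) *
        ((y⁻¹ : (LQuat α β p)ˣ) : LQuat α β p) := by
    rw [mul_sub, sub_mul, ← Algebra.commutes, mul_assoc (algebraMap ℚ_[p] _ _), Units.mul_inv,
      mul_one]
  rw [e, nm_conj]
  exact hz.2

lemma conj_mem_locUnits_Ot (h : IsLevelTower p O Ot O') (y : (LQuat α β p)ˣ) {u : (LQuat α β p)ˣ}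
    (hu : u ∈ locUnits p Ot) :
    y * u * y⁻¹ ∈ locUnits p Ot := by
  refine ⟨h.conj_mem_locOrd_Ot y hu.1, ?_⟩
  have := h.conj_mem_locOrd_Ot y hu.2
  rw [mul_inv_rev, mul_inv_rev, inv_inv, ← mul_assoc]
  exact this

/-- `Ot_p^×` normalizes `O'_p`: commutators of elements of `ℤ_p + P` lie in `P² ⊆ O'_p`. -/
lemma conj_mem_locOrd_O' (h : IsLevelTower p O Ot O') {g : (LQuat α β p)ˣ} (hg : g ∈ locUnits p Ot)
    {v : LQuat α β p}
    (hv : v ∈ locOrd p O') :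
    (g : LQuat α β p) * v * ((g⁻¹ : (LQuat α β p)ˣ) : LQuat α β p) ∈ locOrd p O' := by
  obtain ⟨-, hy⟩ := h.mem_locOrd_Ot.1 hg.1
  obtain ⟨-, hz⟩ := h.mem_locOrd_Ot.1 (h.agree₂.locOrd_le hv)
  set c := tr (g : LQuat α β p) / 2
  set d := tr v / 2
  set y := (g : LQuat α β p) - algebraMap ℚ_[p] _ c with hyd
  set z := v - algebraMap ℚ_[p] _ d with hzd
  obtain ⟨w₁, hw₁, e₁⟩ := exists_p_smul_eq_mul hy hz
  obtain ⟨w₂, hw₂, e₂⟩ := exists_p_smul_eq_mul hz hy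
  have hg' : (g : LQuat α β p) = y + algebraMap ℚ_[p] _ c := by rw [hyd]; abel
  have hv' : v = z + algebraMap ℚ_[p] _ d := by rw [hzd]; abel
  have e : (g : LQuat α β p) * v = v * g + p • (w₁ - w₂) := by
    rw [smul_sub, ← e₁, ← e₂, hg', hv']
    simp only [mul_add, add_mul, Algebra.commutes c z, Algebra.commutes d y, ← map_mul, mul_comm c]
    abel
  rw [e, add_mul, mul_assoc, Units.mul_inv, mul_one, smul_mul_assoc]
  refine add_mem hv (h.smul_mem_locOrd_O' ?_)
  rw [nm_mul, norm_mul]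
  exact mul_le_one₀ ((h.ramified.norm_nm_sub_le _ _).trans (max_le hw₁ hw₂)) (norm_nonneg _)
    (norm_nm_le_one h.order_Ot hg.2)

lemma conj_mem_locUnits_O' (h : IsLevelTower p O Ot O') {g v : (LQuat α β p)ˣ}
    (hg : g ∈ locUnits p Ot)
    (hv : v ∈ locUnits p O') : g * v * g⁻¹ ∈ locUnits p O' := by
  refine ⟨h.conj_mem_locOrd_O' hg hv.1, ?_⟩
  have := h.conj_mem_locOrd_O' hg hv.2
  rw [mul_inv_rev, mul_inv_rev, inv_inv, ← mul_assoc]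
  exact this

end IsLevelTower
end Tower

/-! ### The torsor structures -/

section TorsorStructures

variable {α β : ℚ} {p : ℕ} [hpf : Fact p.Prime] {O Ot O' : Subring (Quat α β)}

/-- The subideals of `a` of the same norm are parametrized by `R'_p^× \ R_p^×`. -/
lemma AgreeAwayFrom.exists_param {R R' : Subring (Quat α β)} (h : AgreeAwayFrom p R R')
    {a : Submodule ℤ (Quat α β)} (ha : a ∈ leftIdeals R) {y : (LQuat α β p)ˣ}
    (hy : loc p a = locRmul (locOrd p R) y) :
    ∃ m : locUnits p R → Psi R' a,
      (∀ u, loc p (m u).1 = locRmul (locOrd p R') (((u : (LQuat α β p)ˣ) * y : (LQuat α β p)ˣ) :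
        LQuat α β p)) ∧
      Function.Surjective m ∧
      ∀ u u', m u = m u' ↔ (u : (LQuat α β p)ˣ) * (u' : (LQuat α β p)ˣ)⁻¹ ∈ locUnits p R' := by
  choose m hm hmp using fun u : locUnits p R => h.exists_mem_Psi ha hy u.2
  refine ⟨fun u => ⟨m u, hm u⟩, hmp, ?_, fun u u' => ?_⟩
  · rintro ⟨b, hb⟩
    obtain ⟨-, -, u, hu, e⟩ := (h.mem_Psi_iff ha hy b).1 hb
    exact ⟨⟨u, hu⟩, Subtype.ext (h.eq_of_loc_eq ha (hm _) hb (by rw [hmp, e]))⟩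
  · have e : (((u : (LQuat α β p)ˣ) * y) * ((u' : (LQuat α β p)ˣ) * y)⁻¹ : (LQuat α β p)ˣ) =
        (u : (LQuat α β p)ˣ) * (u' : (LQuat α β p)ˣ)⁻¹ := by group
    rw [← e, ← locRmul_eq_iff]
    constructor
    · intro h'
      rw [← hmp u, ← hmp u']
      exact congrArg (loc p) (congrArg Subtype.val h')
    · intro h'
      rw [← hmp u, ← hmp u'] at h'
      exact Subtype.ext (h.eq_of_loc_eq ha (hm _) (hm _) h')

namespace IsLevelTower

lemma toH_mem_Ot (h : IsLevelTower p O Ot O') (g : locUnits p O) :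
    toH g ∈ subH p O Ot ↔ (g : (LQuat α β p)ˣ) ∈ locUnits p Ot :=
  toH_mem_subH h.order_Ot h.maximal.1
    (fun _ hz => loc_nsmul_mem (L := asLat O) (fun _ hx => h.smul_mem_Ot hx) hz) g

lemma toH_mem_O' (h : IsLevelTower p O Ot O') (g : locUnits p O) :
    toH g ∈ subH p O O' ↔ (g : (LQuat α β p)ˣ) ∈ locUnits p O' :=
  toH_mem_subH h.order_O' h.maximal.1
    (fun _ hz => h.smul_mem_locOrd_O' (h.mem_locOrd_O.1 hz)) g

lemma normal_subH (h : IsLevelTower p O Ot O') : (subH p O Ot).Normal := by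
  refine ⟨fun n hn g => ?_⟩
  induction n using QuotientGroup.induction_on with | _ n
  induction g using QuotientGroup.induction_on with | _ g
  exact (h.toH_mem_Ot (g * n * g⁻¹)).2 (h.conj_mem_locUnits_Ot g ((h.toH_mem_Ot n).1 hn))

lemma normal_subG (h : IsLevelTower p O Ot O') : (subG p O Ot O').Normal := by
  refine ⟨fun n hn g => ?_⟩
  obtain ⟨n, hn'⟩ := n
  obtain ⟨g, hg⟩ := g
  induction n using QuotientGroup.induction_on with | _ n
  induction g using QuotientGroup.induction_on with | _ g
  exact (h.toH_mem_O' (g * n * g⁻¹)).2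
    (h.conj_mem_locUnits_O' ((h.toH_mem_Ot g).1 hg) ((h.toH_mem_O' n).1 hn))

/-- `𝒢 \ ℋ` is a quotient of the unit group of the residue field of `O_p`, hence cyclic. -/
lemma isCyclic_quotient (h : IsLevelTower p O Ot O') [(subH p O Ot).Normal] :
    IsCyclic (GroupH p O ⧸ subH p O Ot) := by
  have := h.maximal.finite_residue h.ramified
  obtain ⟨z, hz, hgen⟩ := exists_residue_generator h.ramified
  obtain ⟨ζ, rfl⟩ := exists_unit_of_nm_ne_zero (x := z) (by
    rw [← norm_ne_zero_iff, hz]; exact one_ne_zero)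
  let ζ' : locUnits p O := ⟨ζ, (h.mem_locUnits_O ζ).2 hz⟩
  refine ⟨(QuotientGroup.mk (toH ζ') : GroupH p O ⧸ subH p O Ot), fun x => ?_⟩
  induction x using QuotientGroup.induction_on with | _ x
  induction x using QuotientGroup.induction_on with | _ u
  obtain ⟨n, hn⟩ := hgen _ ((h.mem_locUnits_O _).1 u.2)
  refine ⟨n, ?_⟩
  have key : (toH (ζ' ^ n))⁻¹ * toH u ∈ subH p O Ot := by
    refine (h.toH_mem_Ot ((ζ' ^ n)⁻¹ * u)).2 ?_
    rw [mem_locUnits_iff h.order_Ot]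
    have h1 := ((h.mem_locUnits_O _).1 ((ζ' ^ n)⁻¹ * u).2)
    refine ⟨h.mem_locOrd_Ot_of_sub (c := 1) (by simp) ?_, h1⟩
    have e : (((ζ' ^ n)⁻¹ * u : locUnits p O) : (LQuat α β p)ˣ) = (ζ ^ n)⁻¹ * u := rfl
    have e2 : (((ζ ^ n)⁻¹ * u : (LQuat α β p)ˣ) : LQuat α β p) - 1 =
        (((ζ ^ n)⁻¹ : (LQuat α β p)ˣ) : LQuat α β p) *
          ((u : (LQuat α β p)ˣ) - (ζ : LQuat α β p) ^ n) := by
      rw [mul_sub, Units.val_mul, ← Units.val_pow_eq_pow_val, Units.inv_mul]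
    rw [e, map_one, e2, nm_mul, nm_unit_inv, norm_mul, norm_inv, Units.val_pow_eq_pow_val, nm_pow,
      norm_pow, hz, one_pow, inv_one, one_mul]
    exact hn
  change (QuotientGroup.mk (toH ζ') : GroupH p O ⧸ subH p O Ot) ^ (n : ℤ) = QuotientGroup.mk (toH u)
  rw [zpow_natCast, ← QuotientGroup.mk_pow]
  exact QuotientGroup.eq.2 key

/-- The action of `𝒢 \ ℋ` by right translations. If `a_p = O_p y`, then
`Ot_p u y g = Ot_p (u · y g y⁻¹) y`, so the action is the multiplication of the commutative group
`𝒢 \ ℋ` twisted by conjugation by `y`. -/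
lemma exists_torsor_Ot (h : IsLevelTower p O Ot O') [(subH p O Ot).Normal]
    {a : Submodule ℤ (Quat α β)} (ha : a ∈ leftIdeals O) :
    ∃ _ : Torsor (GroupH p O ⧸ subH p O Ot) (Psi Ot a),
      ∀ (g : locUnits p O) (b : Psi Ot a), IsRightTranslate p (g : (LQuat α β p)ˣ) b.1
        ((QuotientGroup.mk (toH g) : GroupH p O ⧸ subH p O Ot) • b).1 := by
  obtain ⟨y, hy⟩ := ha.2 p
  obtain ⟨m, hm, hsurj, hmm⟩ := h.agree₁.exists_param ha hy
  let π : locUnits p O →* GroupH p O ⧸ subH p O Ot :=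
    (QuotientGroup.mk' (subH p O Ot)).comp (QuotientGroup.mk' (congrUnits p O))
  have hπ1 : ∀ u, π u = 1 ↔ (u : (LQuat α β p)ˣ) ∈ locUnits p Ot := fun u =>
    (QuotientGroup.eq_one_iff (toH u)).trans (h.toH_mem_Ot u)
  have hπ : Function.Surjective π :=
    (QuotientGroup.mk'_surjective _).comp (QuotientGroup.mk'_surjective _)
  let ψ : locUnits p O →* locUnits p O :=
    ((MulAut.conj y).toMonoidHom.comp (locUnits p O).subtype).codRestrict (locUnits p O)
      (fun u => h.conj_mem_locUnits_O y u.2)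
  have hψ : ∀ u, ((ψ u : locUnits p O) : (LQuat α β p)ˣ) = y * u * y⁻¹ := fun u => rfl
  have hψs : Function.Surjective ψ := fun u =>
    ⟨⟨y⁻¹ * u * y, by simpa using h.conj_mem_locUnits_O y⁻¹ u.2⟩, by
      apply Subtype.ext; rw [hψ]; group⟩
  have hker : π.ker = (π.comp ψ).ker := by
    ext u
    change π u = 1 ↔ π (ψ u) = 1
    rw [hπ1, hπ1, hψ]
    refine ⟨fun hu => h.conj_mem_locUnits_Ot y hu, fun hu => ?_⟩
    have := h.conj_mem_locUnits_Ot y⁻¹ hu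
    convert this using 1
    group
  obtain ⟨T, hT⟩ := exists_torsor π (π.comp ψ) hπ (hπ.comp hψs) hker m hsurj (fun u u' => by
    rw [hmm, ← mul_inv_eq_one, ← map_inv, ← map_mul, hπ1]
    rfl)
  refine ⟨T, fun g b => ?_⟩
  obtain ⟨u, rfl⟩ := hsurj b
  have hcyc := h.isCyclic_quotient
  have hcomm := hcyc.isMulCommutative.is_comm
  have e : (QuotientGroup.mk (toH g) : GroupH p O ⧸ subH p O Ot) • m u = m (u * ψ g) :=
    hT g u (u * ψ g) (by rw [map_mul, MonoidHom.comp_apply]; exact hcomm.comm _ _)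
  rw [e]
  refine ⟨?_, fun q _ hq => ?_⟩
  · rw [hm, hm, locRmul_mul]
    congr 1
    rw [← Units.val_mul]
    congr 1
    rw [Subgroup.coe_mul, hψ]
    group
  · rw [h.agree₁.loc_eq_of_mem_Psi ha (m _).2 q hq, h.agree₁.loc_eq_of_mem_Psi ha (m _).2 q hq]

/-- The action of `𝒮 \ 𝒢` by left translations of the generator at `p`. It does not depend on the
choice of generator, because `Ot_p^×` normalizes `O'_p^×`. -/
lemma exists_torsor_O' (h : IsLevelTower p O Ot O') [(subG p O Ot O').Normal]
    {b : Submodule ℤ (Quat α β)} (hb : b ∈ leftIdeals Ot) :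
    ∃ _ : Torsor (subH p O Ot ⧸ subG p O Ot O') (Psi O' b),
      ∀ (g : locUnits p O) (γ : subH p O Ot), toH g = (γ : GroupH p O) → ∀ c : Psi O' b,
        IsLeftTranslate p O' (g : (LQuat α β p)ˣ) c.1
          ((QuotientGroup.mk γ : subH p O Ot ⧸ subG p O Ot O') • c).1 := by
  obtain ⟨y, hy⟩ := hb.2 p
  obtain ⟨m, hm, hsurj, hmm⟩ := h.agree₂.exists_param hb hy
  let ι : locUnits p Ot →* locUnits p O := Subgroup.inclusion h.agree₁.locUnits_le
  let κ : locUnits p Ot →* subH p O Ot :=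
    ((QuotientGroup.mk' (congrUnits p O)).comp ι).codRestrict (subH p O Ot)
      (fun u => (h.toH_mem_Ot (ι u)).2 u.2)
  let π : locUnits p Ot →* subH p O Ot ⧸ subG p O Ot O' := (QuotientGroup.mk' _).comp κ
  have hκ : ∀ u, ((κ u : subH p O Ot) : GroupH p O) = toH (ι u) := fun u => rfl
  have hκs : ∀ (g : locUnits p O) (γ : subH p O Ot), toH g = (γ : GroupH p O) →
      ∃ u : locUnits p Ot, (u : (LQuat α β p)ˣ) = g ∧ κ u = γ := by
    intro g γ e
    have hg : (g : (LQuat α β p)ˣ) ∈ locUnits p Ot := (h.toH_mem_Ot g).1 (by rw [e]; exact γ.2)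
    exact ⟨⟨g, hg⟩, rfl, Subtype.ext e⟩
  have hπ1 : ∀ u, π u = 1 ↔ (u : (LQuat α β p)ˣ) ∈ locUnits p O' := fun u =>
    (QuotientGroup.eq_one_iff (κ u)).trans (h.toH_mem_O' (ι u))
  have hπ : Function.Surjective π := by
    refine (QuotientGroup.mk'_surjective _).comp fun γ => ?_
    obtain ⟨g, hg⟩ := QuotientGroup.mk_surjective (γ : GroupH p O)
    obtain ⟨u, -, hu⟩ := hκs g γ hg
    exact ⟨u, hu⟩
  obtain ⟨T, hT⟩ := exists_torsor π π hπ hπ rfl m hsurj (fun u u' => by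
    rw [hmm, ← mul_inv_eq_one, ← map_inv, ← map_mul, hπ1]
    rfl)
  refine ⟨T, fun g γ hgγ c => ?_⟩
  obtain ⟨u, rfl⟩ := hsurj c
  obtain ⟨g', hg', rfl⟩ := hκs g γ hgγ
  have e : (QuotientGroup.mk (κ g') : subH p O Ot ⧸ subG p O Ot O') • m u = m (g' * u) :=
    hT g' u (g' * u) (map_mul _ _ _)
  rw [e, ← hg']
  refine ⟨fun x hx => ?_, fun q _ hq => ?_⟩
  · rw [hm, locRmul_eq_iff] at hx
    rw [hm, locRmul_eq_iff]
    have := h.conj_mem_locUnits_O' g'.2 hx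
    convert this using 1
    rw [Subgroup.coe_mul]
    group
  · rw [h.agree₂.loc_eq_of_mem_Psi hb (m _).2 q hq, h.agree₂.loc_eq_of_mem_Psi hb (m _).2 q hq]

end IsLevelTower
end TorsorStructures

/-! ### Counting -/

section Counting

variable {α β : ℚ} {p : ℕ} [hpf : Fact p.Prime] {O Ot O' : Subring (Quat α β)}

lemma card_eq_of_surjective {A X Y : Type*} {f : A → X} {g : A → Y} (hf : Function.Surjective f)
    (hg : Function.Surjective g) (h : ∀ a a', f a = f a' ↔ g a = g a') :
    Nat.card X = Nat.card Y := by
  refine Nat.card_eq_of_bijective (fun x => g (Function.surjInv hf x))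
    ⟨fun x x' e => ?_, fun y => ?_⟩
  · rw [← Function.surjInv_eq hf x, ← Function.surjInv_eq hf x']
    exact (h _ _).2 e
  · obtain ⟨a, rfl⟩ := hg y
    exact ⟨f a, (h _ _).1 (Function.surjInv_eq hf _)⟩

namespace IsLevelTower

/-- Inside `Ot`, membership in `O'` can be tested at `p`. -/
lemma mem_O'_of_toLocal (h : IsLevelTower p O Ot O') {x : Quat α β} (hx : x ∈ Ot)
    (hxp : toLocal p x ∈ locOrd p O') : x ∈ O' := by
  obtain ⟨n, hn, hnx⟩ := exists_coprime_nsmul_mem h.order_O' hxp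
  have hpx := h.smul_mem_O' hx
  obtain ⟨u, v, huv⟩ := Nat.isCoprime_iff_coprime.2 hn
  have : u • (p • x) + v • (n • x) = x := by
    rw [← natCast_zsmul x p, ← natCast_zsmul x n, smul_smul, smul_smul, ← add_smul, huv, one_smul]
  rw [← this]
  exact O'.add_mem (O'.zsmul_mem hpx u) (O'.zsmul_mem hnx v)

lemma norm_nm_one_add (h : IsLevelTower p O Ot O') {y : LQuat α β p} (hy : ‖nm y‖ < 1) :
    ‖nm (1 + y)‖ = 1 := by
  refine le_antisymm ((h.ramified.norm_nm_add_le _ _).trans (max_le (by simp) hy.le)) ?_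
  by_contra! hc
  have := h.norm_nm_sub_lt hc hy
  simp at this

/-- For `y, z` in the maximal ideal, `(1 + y)(1 + z)⁻¹` lies in `O'_p` exactly when `y - z` does. -/
lemma mul_inv_mem_iff (h : IsLevelTower p O Ot O') {y z : LQuat α β p} (hy : ‖nm y‖ < 1)
    (hz : ‖nm z‖ < 1) {u v : (LQuat α β p)ˣ} (hu : (u : LQuat α β p) = 1 + y)
    (hv : (v : LQuat α β p) = 1 + z) : u * v⁻¹ ∈ locUnits p O' ↔ y - z ∈ locOrd p O' := by
  have hun : ‖nm (u : LQuat α β p)‖ = 1 := by rw [hu]; exact h.norm_nm_one_add hy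
  have hvn : ‖nm (v : LQuat α β p)‖ = 1 := by rw [hv]; exact h.norm_nm_one_add hz
  have hn : ‖nm ((u * v⁻¹ : (LQuat α β p)ˣ) : LQuat α β p)‖ = 1 := by
    rw [Units.val_mul, nm_mul, nm_unit_inv, norm_mul, norm_inv, hun, hvn, inv_one, one_mul]
  have hd := h.norm_nm_sub_lt hy hz
  have hzv : ‖nm (z * ((v⁻¹ : (LQuat α β p)ˣ) : LQuat α β p))‖ < 1 := by
    rw [nm_mul, nm_unit_inv, norm_mul, norm_inv, hvn, inv_one, mul_one]; exact hz
  have e : ((u * v⁻¹ : (LQuat α β p)ˣ) : LQuat α β p) =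
      1 + (y - z) - (y - z) * (z * ((v⁻¹ : (LQuat α β p)ˣ) : LQuat α β p)) := by
    rw [← Units.mul_left_inj v, Units.val_mul, mul_assoc, Units.inv_mul, mul_one, sub_mul,
      mul_assoc (y - z), mul_assoc z, Units.inv_mul, mul_one, hu, hv]
    noncomm_ring
  rw [mem_locUnits_iff h.order_O', and_iff_left hn, e,
    Submodule.sub_mem_iff_left _ (h.mul_mem_locOrd_O' hd hzv),
    add_mem_cancel_left (one_mem_locOrd p O')]

/-- The `p` subideals correspond to `Ot / O'`, through `x ↦ 1 + (x - tr(x)/2)`. -/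
lemma ncard_Psi (h : IsLevelTower p O Ot O') {b : Submodule ℤ (Quat α β)}
    (hb : b ∈ leftIdeals Ot) : (Psi O' b).ncard = p := by
  obtain ⟨y, hy⟩ := hb.2 p
  obtain ⟨m, -, hsurj, hmm⟩ := h.agree₂.exists_param hb hy
  have h0 : ∀ x : Ot, ‖nm (toLocal p (x : Quat α β) -
      algebraMap ℚ_[p] _ (tr (toLocal p (x : Quat α β)) / 2))‖ < 1 := fun x =>
    (h.mem_locOrd_Ot.1 (toLocal_mem_loc (L := asLat Ot) x.2)).2
  have h1 : ∀ x : Ot, ∃ u : locUnits p Ot, ((u : (LQuat α β p)ˣ) : LQuat α β p) =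
      1 + (toLocal p (x : Quat α β) -
        algebraMap ℚ_[p] _ (tr (toLocal p (x : Quat α β)) / 2)) := by
    intro x
    have hn := h.norm_nm_one_add (h0 x)
    obtain ⟨u, hu⟩ := exists_unit_of_nm_ne_zero (norm_ne_zero_iff.1 (hn.symm ▸ one_ne_zero))
    refine ⟨⟨u, (mem_locUnits_iff h.order_Ot u).2 ⟨?_, by rw [hu]; exact hn⟩⟩, hu⟩
    rw [hu]
    exact add_mem (one_mem_locOrd p Ot) (h.mem_locOrd_Ot_of_lt (h0 x))
  choose f hf using h1
  have half : ∀ {t : ℚ_[p]}, ‖t‖ ≤ 1 → ‖t / 2‖ ≤ 1 := fun {t} ht => by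
    rwa [norm_div, norm_two_eq_one h.two_lt, div_one]
  have hscal : ∀ {z : LQuat α β p} {t : ℚ_[p]}, ‖t‖ ≤ 1 →
      (z - algebraMap ℚ_[p] _ t ∈ locOrd p O' ↔ z ∈ locOrd p O') := fun ht =>
    Submodule.sub_mem_iff_left _ (algebraMap_mem_locOrd ht)
  have hfs : Function.Surjective fun x => m (f x) := by
    intro c
    obtain ⟨u, rfl⟩ := hsurj c
    -- Write `u = c (1 + y)` with `c` scalar and `y` in the maximal ideal, and approximate `y`.
    set t := tr ((u : (LQuat α β p)ˣ) : LQuat α β p) / 2 with ht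
    have hu := h.mem_locOrd_Ot.1 u.2.1
    have hun := ((mem_locUnits_iff h.order_Ot _).1 u.2).2
    have htn : ‖t‖ = 1 := by
      refine le_antisymm (half (norm_tr_le_one h.order_Ot u.2.1)) ?_
      by_contra! hc
      have h2 := h.norm_nm_add_lt hu.2 (y := algebraMap ℚ_[p] _ t) (by
        rw [nm_algebraMap, norm_pow]; exact pow_lt_one₀ (norm_nonneg _) hc two_ne_zero)
      rw [sub_add_cancel, hun] at h2
      exact lt_irrefl _ h2
    have ht0 : t ≠ 0 := by rw [← norm_ne_zero_iff, htn]; exact one_ne_zero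
    set w := algebraMap ℚ_[p] (LQuat α β p) t⁻¹ *
      (((u : (LQuat α β p)ˣ) : LQuat α β p) - algebraMap ℚ_[p] _ t) with hw
    have hw1 : ‖nm w‖ < 1 := by
      rw [hw, nm_mul, nm_algebraMap, norm_mul, norm_pow, norm_inv, htn, inv_one, one_pow, one_mul]
      exact hu.2
    have hut : ((u : (LQuat α β p)ˣ) : LQuat α β p) = algebraMap ℚ_[p] _ t * (1 + w) := by
      rw [hw, mul_add, ← mul_assoc, ← map_mul, mul_inv_cancel₀ ht0, map_one, one_mul, mul_one]
      abel
    obtain ⟨v, hv⟩ := exists_unit_of_nm_ne_zero (x := 1 + w)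
      (norm_ne_zero_iff.1 ((h.norm_nm_one_add hw1).symm ▸ one_ne_zero))
    obtain ⟨x, hx, s, hs, e⟩ := exists_approx 1 (h.mem_locOrd_Ot_of_lt hw1)
    refine ⟨⟨x, hx⟩, (hmm _ _).2 ?_⟩
    have key : (f ⟨x, hx⟩ : (LQuat α β p)ˣ) * v⁻¹ ∈ locUnits p O' := by
      rw [h.mul_inv_mem_iff (h0 ⟨x, hx⟩) hw1 (hf _) hv, sub_right_comm,
        hscal (half (norm_tr_le_one h.order_Ot (toLocal_mem_loc (L := asLat Ot) hx))),
        eq_sub_of_add_eq e.symm, sub_sub_cancel_left, pow_one]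
      exact neg_mem (h.smul_mem_locOrd_O' (norm_nm_le_one h.order_Ot hs))
    have huv : v * (u : (LQuat α β p)ˣ)⁻¹ ∈ locUnits p O' := by
      rw [← inv_mem_iff, mul_inv_rev, inv_inv]
      have e2 : (((u : (LQuat α β p)ˣ) * v⁻¹ : (LQuat α β p)ˣ) : LQuat α β p) =
          algebraMap ℚ_[p] _ t := by
        rw [Units.val_mul, hut, ← hv, mul_assoc, Units.mul_inv, mul_one]
      rw [mem_locUnits_iff h.order_O', e2, nm_algebraMap, norm_pow, htn, one_pow]
      exact ⟨algebraMap_mem_locOrd htn.le, rfl⟩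
    have := (locUnits p O').mul_mem key huv
    convert this using 1
    group
  have hcard := card_eq_of_surjective hfs
    (QuotientAddGroup.mk_surjective (s := O'.toAddSubgroup.addSubgroupOf Ot.toAddSubgroup))
    (fun x x' => by
      have e : toLocal p (x : Quat α β) -
            algebraMap ℚ_[p] _ (tr (toLocal p (x : Quat α β)) / 2) -
          (toLocal p (x' : Quat α β) -
            algebraMap ℚ_[p] _ (tr (toLocal p (x' : Quat α β)) / 2)) =
          toLocal p (((-x + x' : Ot) : Quat α β)) * (-1) -
            algebraMap ℚ_[p] _ (tr (toLocal p (x : Quat α β)) / 2) -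
            -algebraMap ℚ_[p] _ (tr (toLocal p (x' : Quat α β)) / 2) := by
        push_cast
        rw [map_add, map_neg]
        noncomm_ring
      rw [hmm, h.mul_inv_mem_iff (h0 x) (h0 x') (hf x) (hf x'), e, ← map_neg (algebraMap _ _),
        hscal (by
          rw [norm_neg]
          exact half (norm_tr_le_one h.order_Ot (toLocal_mem_loc (L := asLat Ot) x'.2))),
        hscal (half (norm_tr_le_one h.order_Ot (toLocal_mem_loc (L := asLat Ot) x.2))),
        mul_neg, mul_one, neg_mem_iff]
      refine Iff.trans ⟨fun hx => ?_, fun hx => ?_⟩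
        (QuotientAddGroup.eq (s := O'.toAddSubgroup.addSubgroupOf Ot.toAddSubgroup)).symm
      · exact h.mem_O'_of_toLocal (-x + x' : Ot).2 hx
      · exact toLocal_mem_loc (L := asLat O') hx)
  rw [← Nat.card_coe_set_eq, hcard]
  exact h.index.2.2

end IsLevelTower
end Counting

/-! ### Right orders and inequivalence -/

section RightOrders

variable {α β : ℚ} {p : ℕ} [hpf : Fact p.Prime] {O Ot O' : Subring (Quat α β)}

lemma mul_mem_loc_of_mem_rightOrder {q : ℕ} [Fact q.Prime] {L : Submodule ℤ (Quat α β)}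
    {x : Quat α β} (hx : x ∈ rightOrder L) {z : LQuat α β q} (hz : z ∈ loc q L) :
    z * toLocal q x ∈ loc q L := by
  induction hz using Submodule.span_induction with
  | mem z h =>
    obtain ⟨y, hy, rfl⟩ := h
    rw [← map_mul]
    exact toLocal_mem_loc (hx y hy)
  | zero => simp
  | add y z _ _ hy hz => rw [add_mul]; exact add_mem hy hz
  | smul c z _ hz => rw [smul_mul_assoc]; exact Submodule.smul_mem _ _ hz

lemma IsLevelTower.rightOrder_le (h : IsLevelTower p O Ot O') {b c d : Submodule ℤ (Quat α β)}
    (hb : b ∈ leftIdeals Ot) (hc : c ∈ Psi O' b) (hd : d ∈ Psi O' b) :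
    rightOrder c ≤ rightOrder d := by
  intro x hx w hw
  refine mem_of_forall_loc hd.1.1 fun q _ => ?_
  rw [map_mul]
  have hw' := toLocal_mem_loc (q := q) hw
  rcases eq_or_ne q p with rfl | hq
  · obtain ⟨y, hy⟩ := hb.2 q
    obtain ⟨-, -, u, hu, hcu⟩ := (h.agree₂.mem_Psi_iff hb hy c).1 hc
    obtain ⟨-, -, v, hv, hdv⟩ := (h.agree₂.mem_Psi_iff hb hy d).1 hd
    have h1 : ((u * y : (LQuat α β q)ˣ) : LQuat α β q) * toLocal q x ∈ loc q c := by
      refine mul_mem_loc_of_mem_rightOrder hx ?_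
      rw [hcu]
      exact generator_mem _ _
    rw [hcu, mem_locRmul] at h1
    -- Conjugation by `v u⁻¹ ∈ Ot_p^×` preserves `O'_p`.
    have h2 := h.conj_mem_locOrd_O' ((locUnits q Ot).mul_mem hv ((locUnits q Ot).inv_mem hu)) h1
    rw [hdv, mem_locRmul] at hw' ⊢
    have h3 := mul_mem_locOrd hw' h2
    convert h3 using 1
    simp [mul_assoc]
  · rw [h.agree₂.loc_eq_of_mem_Psi hb hd q hq] at hw' ⊢
    rw [← h.agree₂.loc_eq_of_mem_Psi hb hc q hq] at hw' ⊢
    exact mul_mem_loc_of_mem_rightOrder hx hw'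

lemma IsRamifiedOver.neg_of_real {a b : ℝ} (h : IsRamifiedOver ℝ a b) : a < 0 ∧ b < 0 := by
  constructor <;> by_contra! hc
  · refine h.nm_ne_zero (x := ⟨√a, 1, 0, 0⟩) (fun e => ?_) (by simp [nm_eq, Real.sq_sqrt hc])
    simpa using congrArg QuaternionAlgebra.imI e
  · refine h.nm_ne_zero (x := ⟨√b, 0, 1, 0⟩) (fun e => ?_) (by simp [nm_eq, Real.sq_sqrt hc])
    simpa using congrArg QuaternionAlgebra.imJ e

lemma nm_nonneg_of_real (h : IsRamifiedOver ℝ (α : ℝ) (β : ℝ)) (x : Quat α β) : 0 ≤ nm x := by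
  obtain ⟨ha, hb⟩ := h.neg_of_real
  have ha' : α < 0 := by exact_mod_cast ha
  have hb' : β < 0 := by exact_mod_cast hb
  rw [nm_eq]
  have h1 := mul_nonneg (neg_nonneg.2 ha'.le) (sq_nonneg x.imI)
  have h2 := mul_nonneg (neg_nonneg.2 hb'.le) (sq_nonneg x.imJ)
  have h3 := mul_nonneg (mul_pos_of_neg_of_neg ha' hb').le (sq_nonneg x.imK)
  nlinarith [sq_nonneg x.re]

/-- If `b = b x`, then `x` is a unit of the right order of `b`, which lies in a conjugate of `Ot`
at `p`. By definiteness `tr(x)² ≤ 4`, and `p ∣ tr(x)² - 4` forces `x = ±1` when `p > 3`. -/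
lemma IsLevelTower.eq_one_or_neg_one (h : IsLevelTower p O Ot O') (hp : 3 < p)
    (hreal : IsRamifiedOver ℝ (α : ℝ) (β : ℝ)) {b : Submodule ℤ (Quat α β)}
    (hb : b ∈ leftIdeals Ot) {x : (Quat α β)ˣ} (hx : b = rmul b x) :
    (x : Quat α β) = 1 ∨ (x : Quat α β) = -1 := by
  have key : ∀ (q : ℕ) [Fact q.Prime], ∃ w ∈ locUnits q Ot,
      nm (w : LQuat α β q) = ((nrd (x : Quat α β) : ℚ) : ℚ_[q]) ∧
      tr (w : LQuat α β q) = ((trd (x : Quat α β) : ℚ) : ℚ_[q]) := by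
    intro q _
    obtain ⟨z, hz⟩ := hb.2 q
    let X : (LQuat α β q)ˣ :=
      Units.map ((toLocal q : Quat α β →+* LQuat α β q) : Quat α β →* LQuat α β q) x
    have e : locRmul (locOrd q Ot) ((z * X : (LQuat α β q)ˣ) : LQuat α β q) =
        locRmul (locOrd q Ot) z := by
      rw [← hz]
      conv_rhs => rw [hx]
      rw [loc_rmul, hz, locRmul_mul]
      rfl
    refine ⟨_, (locRmul_eq_iff _ _).1 e, ?_, ?_⟩
    · rw [Units.val_mul, Units.val_mul, nm_conj, ← nm_toLocal]; rfl
    · rw [Units.val_mul, Units.val_mul, tr_conj, ← tr_toLocal]; rfl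
  have hn : nrd (x : Quat α β) = 1 := by
    refine eq_of_forall_norm_eq (nm_nonneg_of_real hreal _) zero_le_one fun q _ => ?_
    obtain ⟨w, hw, hwn, -⟩ := key q
    rw [← hwn, ((mem_locUnits_iff h.order_Ot w).1 hw).2, Rat.cast_one, norm_one]
  obtain ⟨t, ht⟩ := exists_int_of_norm_le_one (r := trd (x : Quat α β)) fun q _ => by
    obtain ⟨w, hw, -, hwt⟩ := key q
    rw [← hwt]
    exact norm_tr_le_one h.order_Ot hw.1
  have hsub : nm (2 * (x : Quat α β) - algebraMap ℚ _ (t : ℚ)) = 4 - (t : ℚ) ^ 2 := by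
    have e1 := nm_two_mul_sub (x : Quat α β)
    change nm (2 * (x : Quat α β) - algebraMap ℚ _ (trd (x : Quat α β))) =
      -(trd (x : Quat α β) ^ 2 - 4 * nrd (x : Quat α β)) at e1
    rw [← ht, hn] at e1
    rw [e1]; ring
  have ht4 : t ^ 2 ≤ 4 := by
    have := nm_nonneg_of_real hreal (2 * (x : Quat α β) - algebraMap ℚ _ (t : ℚ))
    rw [hsub] at this
    have h2 : ((t ^ 2 : ℤ) : ℚ) ≤ ((4 : ℤ) : ℚ) := by push_cast; linarith
    exact_mod_cast h2
  have hdvd : (p : ℤ) ∣ t ^ 2 - 4 := by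
    obtain ⟨w, hw, hwn, hwt⟩ := key p
    have h1 := (h.mem_locOrd_Ot.1 hw.1).2
    have e2 : (2 : LQuat α β p) * w - algebraMap ℚ_[p] _ (tr (w : LQuat α β p)) =
        2 • ((w : LQuat α β p) - algebraMap ℚ_[p] _ (tr (w : LQuat α β p) / 2)) := by
      rw [smul_sub, two_mul, two_smul, two_smul,
        ← map_add (algebraMap ℚ_[p] (LQuat α β p)), add_halves]
    have e3 := congrArg norm (nm_two_mul_sub (w : LQuat α β p))
    rw [e2, nm_nsmul, norm_mul, norm_pow, norm_neg, hwn, hwt, hn, ← ht, Nat.cast_ofNat,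
      norm_two_eq_one h.two_lt, one_pow, one_mul] at e3
    rw [hwt, ← ht, e3] at h1
    rw [← Padic.norm_intCast_lt_one_iff (p := p)]
    have e4 : ((t ^ 2 - 4 : ℤ) : ℚ_[p]) = ((t : ℚ) : ℚ_[p]) ^ 2 - 4 * ((1 : ℚ) : ℚ_[p]) := by
      push_cast; ring
    rw [e4]
    exact h1
  have hp' : (p : ℤ) ≠ 4 := fun e => by
    have : p = 4 := by exact_mod_cast e
    have hpr := hpf.out
    rw [this] at hpr
    exact absurd hpr (by norm_num)
  have hp3 : (3 : ℤ) < p := by exact_mod_cast hp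
  have ht2 : t = 2 ∨ t = -2 := by
    have hl : -2 ≤ t := by nlinarith
    have hu : t ≤ 2 := by nlinarith
    have hz : t ^ 2 - 4 = 0 := by
      by_contra hne
      have h3 := Int.le_of_dvd (show 0 < -(t ^ 2 - 4) by omega) ((dvd_neg).2 hdvd)
      have h4 : (p : ℤ) = 4 ∨ t ^ 2 = 0 := by
        by_contra! hcon
        have : 0 < t ^ 2 := lt_of_le_of_ne (sq_nonneg t) (Ne.symm hcon.2)
        omega
      rcases h4 with h4 | h4
      · exact hp' h4
      · rw [h4] at h3; omega
    have : (t - 2) * (t + 2) = 0 := by linarith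
    rcases mul_eq_zero.1 this with h5 | h5
    · left; omega
    · right; omega
  have hzero : 2 * (x : Quat α β) - algebraMap ℚ _ (t : ℚ) = 0 := by
    have h0 : nm (2 * (x : Quat α β) - algebraMap ℚ _ (t : ℚ)) = 0 := by
      rw [hsub]; rcases ht2 with rfl | rfl <;> norm_num
    apply toLocal_injective p
    rw [map_zero, ← h.ramified.nm_eq_zero, nm_toLocal]
    change ((nm (2 * (x : Quat α β) - algebraMap ℚ _ (t : ℚ)) : ℚ) : ℚ_[p]) = 0
    rw [h0, Rat.cast_zero]
  have hx2 : (2 : ℕ) • (x : Quat α β) = algebraMap ℚ _ (t : ℚ) := by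
    rw [nsmul_eq_mul]; exact_mod_cast sub_eq_zero.1 hzero
  rcases ht2 with rfl | rfl
  · left
    refine nsmul_cancel two_ne_zero (hx2.trans ?_)
    rw [nsmul_eq_mul, mul_one, ← map_natCast (algebraMap ℚ (Quat α β))]; norm_num
  · right
    refine nsmul_cancel two_ne_zero (hx2.trans ?_)
    rw [nsmul_eq_mul, mul_neg, mul_one, ← map_natCast (algebraMap ℚ (Quat α β)), ← map_neg]
    norm_num

lemma IsLevelTower.ncard_Cls_Psi (h : IsLevelTower p O Ot O') (hp : 3 < p)
    (hreal : IsRamifiedOver ℝ (α : ℝ) (β : ℝ)) {b : Submodule ℤ (Quat α β)}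
    (hb : b ∈ leftIdeals Ot) : (Cls O' (Psi O' b)).ncard = p := by
  rw [← h.ncard_Psi hb, ← Nat.card_coe_set_eq, ← Nat.card_coe_set_eq]
  symm
  refine Nat.card_eq_of_bijective (fun c : Psi O' b =>
    (⟨cls ⟨c.1, c.2.1⟩, ⟨c.1, c.2.1⟩, c.2, rfl⟩ : Cls O' (Psi O' b))) ⟨?_, ?_⟩
  · rintro ⟨c, hc⟩ ⟨d, hd⟩ e
    obtain ⟨x, hx⟩ := Quotient.exact (congrArg Subtype.val e)
    change c = rmul d x at hx
    have hbx : b = rmul b x := by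
      refine h.agree₂.eq_of_mem_Psi hb (rmul_mem_leftIdeals hb x) hc ?_
      rw [hx]
      exact h.agree₂.rmul_mem_Psi hb hd x
    refine Subtype.ext ?_
    change c = d
    rw [hx]
    rcases h.eq_one_or_neg_one hp hreal hb hbx with e | e
    · rw [e, rmul_one]
    · ext z
      rw [mem_rmul, show ((x⁻¹ : (Quat α β)ˣ) : Quat α β) = -1 by
        rw [← Units.mul_left_inj x, Units.inv_mul, e]; simp]
      simp
  · rintro ⟨_, c, hc, rfl⟩
    exact ⟨⟨c, hc⟩, rfl⟩

end RightOrders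

end QuatIdeals

end

theorem mainTheorem2 (p : ℕ) [Fact p.Prime] (hp : 2 < p) (α β : ℚ)
    (hram : IsRamifiedExactlyAt α β p)
    (O Ot O' : Subring (Quat α β)) (hO : IsMaximalOrder O)
    (hOt : (Ot : Set (Quat α β)) = {x | x ∈ O ∧ ∃ k : ℤ, discr x = (p : ℚ) * k})
    (hO' : IsOrderOfIndex p Ot O') :
    -- (1)
    ClassesDecompose O Ot ∧
    -- (2)
    (∃ _ : (subH p O Ot).Normal, IsCyclic (GroupH p O ⧸ subH p O Ot) ∧
      ∀ a ∈ leftIdeals O,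
        ∃ _ : Torsor (GroupH p O ⧸ subH p O Ot) (Psi Ot a),
          ∀ (g : locUnits p O) (b : Psi Ot a),
            IsRightTranslate p (g : (LQuat α β p)ˣ) b.1
              ((QuotientGroup.mk (toH g) : GroupH p O ⧸ subH p O Ot) • b).1) ∧
    -- (3)
    ClassesDecompose Ot O' ∧
    (∀ b ∈ leftIdeals Ot, (Psi O' b).ncard = p ∧ (3 < p → (Cls O' (Psi O' b)).ncard = p)) ∧
    -- (4)
    (∀ b ∈ leftIdeals Ot, ∀ c ∈ Psi O' b, ∀ d ∈ Psi O' b, rightOrder c = rightOrder d) ∧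
    -- (5)
    (∃ _ : (subG p O Ot O').Normal,
      ∀ b ∈ leftIdeals Ot,
        ∃ _ : Torsor (subH p O Ot ⧸ subG p O Ot O') (Psi O' b),
          ∀ (g : locUnits p O) (γ : subH p O Ot), toH g = (γ : GroupH p O) →
            ∀ c : Psi O' b,
              IsLeftTranslate p O' (g : (LQuat α β p)ˣ) c.1
                ((QuotientGroup.mk γ : subH p O Ot ⧸ subG p O Ot O') • c).1) := by
  have h : IsLevelTower p O Ot O' := ⟨hp, (hram.2 p).2 rfl, hO, hOt, hO'⟩
  have hn := h.normal_subH
  have hs := h.normal_subG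
  exact ⟨h.agree₁.classesDecompose,
    ⟨hn, h.isCyclic_quotient, fun a ha => h.exists_torsor_Ot ha⟩,
    h.agree₂.classesDecompose,
    fun b hb => ⟨h.ncard_Psi hb, fun hp3 => h.ncard_Cls_Psi hp3 hram.1 hb⟩,
    fun b hb c hc d hd => le_antisymm (h.rightOrder_le hb hc hd) (h.rightOrder_le hb hd hc),
    ⟨hs, fun b hb => h.exists_torsor_O' hb⟩⟩
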